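/- Let $\Omega=(0,1)$ with Lebesgue measure $\mathfrak m$, and let $\phi\colon\mathbb R\to[0,\infty)$ be symmetric ($\phi(-x)=\phi(x)$), nonincreasing on $(0,\infty)$ and locally integrable. Put $\Phi(x)=\int_0^x\phi(y)\,dy$ and $W_\Phi(x)=\int_0^x\Phi(y)\,dy$. Let $\mathscr K\subset L^2(\Omega)$ be the cone of those elements that have a nondecreasing, right-continuous representative on $\Omega$. For $X\in L^2(\Omega)$ write $(\Phi*\rho(X))(m)=\int_\Omega\Phi(X(m)-X(\omega))\,d\omega$, which is the function $\Phi*\rho$ evaluated at $X(m)$ for $\rho=X_\#\mathfrak m$, and which belongs to $L^2(\Omega)$. Let $\bar X\in\mathscr K$, $\bar V\in L^2(\Omega)$ and $\bar\Psi=\bar V+\Phi*\rho(\bar X)\in L^2(\Omega)$. Define $\bar{\mathcal V}\colon L^2(\Omega)\to(-\infty,+\infty]$ by $$\bar{\mathcal V}(X)=\frac12\iint_{\Omega\times\Omega}W_\Phi(X(m)-X(\omega))\,d\omega\,dm-\int_\Omega\bar\Psi X\,dm+I_{\mathscr K}(X),$$ where $I_{\mathscr K}=0$ on $\mathscr K$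 and $I_{\mathscr K}=+\infty$ elsewhere. For a proper $F\colon L^2(\Omega)\to(-\infty,+\infty]$ let $$\partial F(X)=\Big\{Y\in L^2(\Omega):F(Z)\ge F(X)+\int_\Omega Y(Z-X)\,dm\ \text{ for all }Z\in L^2(\Omega)\Big\},$$ which is empty where $F(X)=+\infty$, and let $\partial^\circ F(X)$ be the set of elements of minimal norm of $\partial F(X)$. A curve $X_t\colon[0,\infty)\to L^2(\Omega)$ is called an $L^2$-gradient flow of $F$ if it is absolutely continuous on every compact subinterval of $[0,\infty)$ and, for a.e. $t>0$, its derivative $\dot X_t$ exists in $L^2(\Omega)$ and $-\dot X_t\in\partial F(X_t)$. Then $\bar{\mathcal V}$ is proper, convex and lower semicontinuous on $L^2(\Omega)$, and there is exactly one $L^2$-gradient flow $X_t$ of $\bar{\mathcal V}$ with $X_0=\bar X$. It satisfies $X_t\in\mathscr K$ for all $t\ge0$ and evolves by the minimal selection of the subdifferential: $$-\dot X_t\in\partial^\circ\bar{\mathcal V}(X_t)\qquad\text{for a.e. }t>0.$$ -/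

import Mathlib

open MeasureTheory Set

namespace EulerAlignment

/-- Standing assumptions on the communication protocol `φ`: it is nonnegative, symmetric, radially
nonincreasing and locally integrable. It may be singular at the origin, so the monotonicity is
required away from `0` only. -/
structure IsProtocol (φ : ℝ → ℝ) : Prop where
  nonneg : ∀ x, 0 ≤ φ x
  symm : ∀ x, φ (-x) = φ x
  antitone : AntitoneOn φ (Ioi 0)
  locInt : LocallyIntegrable φ volume

/-- Lebesgue measure on `Ω = (0, 1)`. -/
noncomputable abbrev mu : Measure ℝ := volume.restrict (Ioo (0 : ℝ) 1)

/-- The real Hilbert space `L²(Ω)`, `Ω = (0, 1)`. -/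
abbrev L2 : Type := Lp ℝ 2 mu

/-- The primitive `Φ(x) = ∫₀ˣ φ(y) dy`. -/
noncomputable def Phi (φ : ℝ → ℝ) (x : ℝ) : ℝ := ∫ y in (0 : ℝ)..x, φ y

/-- The second primitive `W_Φ(x) = ∫₀ˣ Φ(y) dy`. -/
noncomputable def WPhi (φ : ℝ → ℝ) (x : ℝ) : ℝ := ∫ y in (0 : ℝ)..x, Phi φ y

theorem IsProtocol.intervalIntegrable {φ : ℝ → ℝ} (h : IsProtocol φ) (a b : ℝ) :
    IntervalIntegrable φ volume a b :=
  (h.locInt.integrableOn_isCompact isCompact_uIcc).intervalIntegrable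

theorem IsProtocol.continuous_Phi {φ : ℝ → ℝ} (h : IsProtocol φ) : Continuous (Phi φ) :=
  intervalIntegral.continuous_primitive h.intervalIntegrable 0

theorem IsProtocol.Phi_neg {φ : ℝ → ℝ} (h : IsProtocol φ) (x : ℝ) : Phi φ (-x) = -Phi φ x := by
  have h1 : ∫ y in (0 : ℝ)..x, φ (-y) = ∫ y in (-x)..(-0), φ y :=
    intervalIntegral.integral_comp_neg φ
  simp only [h.symm, neg_zero] at h1
  rw [Phi, Phi, h1, intervalIntegral.integral_symm]

theorem IsProtocol.abs_Phi_le {φ : ℝ → ℝ} (h : IsProtocol φ) (x : ℝ) :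
    |Phi φ x| ≤ (Phi φ 1 + φ 1) * (1 + |x|) := by
  have key : ∀ y : ℝ, 0 ≤ y → |Phi φ y| ≤ (Phi φ 1 + φ 1) * (1 + |y|) := by
    intro y hy
    have hp : ∀ a b : ℝ, a ≤ b → 0 ≤ ∫ z in a..b, φ z := fun a b hab =>
      intervalIntegral.integral_nonneg hab fun z _ => h.nonneg z
    have h0 : 0 ≤ Phi φ y := hp 0 y hy
    have h1 : 0 ≤ Phi φ 1 := hp 0 1 zero_le_one
    have hφ1 := h.nonneg 1
    have hsplit : Phi φ 1 + ∫ z in (1 : ℝ)..y, φ z = Phi φ y :=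
      intervalIntegral.integral_add_adjacent_intervals (h.intervalIntegrable 0 1)
        (h.intervalIntegrable 1 y)
    have hle : ∫ z in (1 : ℝ)..y, φ z ≤ φ 1 * y := by
      rcases le_total y 1 with hy1 | hy1
      · have := hp y 1 hy1
        rw [intervalIntegral.integral_symm]
        nlinarith [mul_nonneg hφ1 hy]
      · have : ∫ z in (1 : ℝ)..y, φ z ≤ ∫ _z in (1 : ℝ)..y, φ 1 := by
          apply intervalIntegral.integral_mono_on hy1 (h.intervalIntegrable 1 y)
            intervalIntegrable_const
          intro z hz
          exact h.antitone (mem_Ioi.2 one_pos) (mem_Ioi.2 (one_pos.trans_le hz.1)) hz.1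
        rw [intervalIntegral.integral_const, smul_eq_mul] at this
        nlinarith
    rw [abs_of_nonneg h0, abs_of_nonneg hy]
    nlinarith [mul_nonneg h1 hy]
  rcases le_total 0 x with hx | hx
  · exact key x hx
  · have := key (-x) (by linarith)
    rwa [h.Phi_neg, abs_neg, abs_neg] at this

/-- The function `m ↦ ∫_Ω Φ(X(m) - X(ω)) dω`, which equals `(Φ ∗ ρ)(X(m))` for the push-forward
`ρ` of Lebesgue measure on `Ω` under `X`. -/
noncomputable def convFun (φ : ℝ → ℝ) (X : ℝ → ℝ) (m : ℝ) : ℝ := ∫ ω, Phi φ (X m - X ω) ∂mu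

theorem IsProtocol.memLp_convFun {φ : ℝ → ℝ} (h : IsProtocol φ) {X : ℝ → ℝ}
    (hX : StronglyMeasurable X) (hL2 : MemLp X 2 mu) : MemLp (convFun φ X) 2 mu := by
  have hmeas : StronglyMeasurable (convFun φ X) := by
    have : StronglyMeasurable (fun p : ℝ × ℝ => Phi φ (X p.1 - X p.2)) :=
      h.continuous_Phi.comp_stronglyMeasurable
        ((hX.comp_measurable measurable_fst).sub (hX.comp_measurable measurable_snd))
    exact this.integral_prod_right
  have hint : Integrable (fun m => |X m|) mu := (hL2.integrable one_le_two).abs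
  obtain ⟨C, hC⟩ : ∃ C, C = Phi φ 1 + φ 1 := ⟨_, rfl⟩
  obtain ⟨A, hA⟩ : ∃ A, A = ∫ ω, |X ω| ∂mu := ⟨_, rfl⟩
  have hC0 : 0 ≤ C := by
    rw [hC]
    exact add_nonneg (intervalIntegral.integral_nonneg zero_le_one fun z _ => h.nonneg z)
      (h.nonneg 1)
  have hbd : MemLp (fun m => C * (1 + A) + C * |X m|) 2 mu :=
    (memLp_const (C * (1 + A))).add (hL2.abs.const_mul C)
  refine hbd.mono' hmeas.aestronglyMeasurable (Filter.Eventually.of_forall fun m => ?_)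
  have hint2 : Integrable (fun ω => C * (1 + |X m|) + C * |X ω|) mu :=
    (integrable_const _).add (hint.const_mul C)
  have h1 : ‖convFun φ X m‖ ≤ ∫ ω, (C * (1 + |X m|) + C * |X ω|) ∂mu := by
    refine norm_integral_le_of_norm_le hint2 (Filter.Eventually.of_forall fun ω => ?_)
    have h2 := h.abs_Phi_le (X m - X ω)
    have h3 : |X m - X ω| ≤ |X m| + |X ω| := abs_sub _ _
    rw [← hC] at h2
    rw [Real.norm_eq_abs]
    nlinarith
  have h4 : ∫ ω, (C * (1 + |X m|) + C * |X ω|) ∂mu = C * (1 + |X m|) + C * A := by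
    rw [integral_add (integrable_const _) (hint.const_mul C), integral_const, hA]
    simpa using integral_const_mul C _
  rw [h4] at h1
  linarith

/-- `Φ ∗ ρ(X)` as an element of `L²(Ω)`. -/
noncomputable def conv {φ : ℝ → ℝ} (h : IsProtocol φ) (X : L2) : L2 := 
  (h.memLp_convFun (Lp.stronglyMeasurable X) (Lp.memLp X)).toLp (convFun φ X)

/-- The natural velocity `Ψ[X, V] = V + Φ ∗ ρ(X)`. -/
noncomputable def naturalVelocity {φ : ℝ → ℝ} (h : IsProtocol φ) (X V : L2) : L2 := V + conv h X

/-- The cone `𝒦` of the elements of `L²(Ω)` that are nondecreasing and right-continuous on `Ω`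
(as elements of `L²(Ω)`, i.e. after a choice of representative). -/
def coneK : Set L2 :=
  {X | ∃ f : ℝ → ℝ, MonotoneOn f (Ioo 0 1) ∧
    (∀ m ∈ Ioo (0 : ℝ) 1, ContinuousWithinAt f (Ici m) m) ∧ X =ᵐ[mu] f}

open Classical in
/-- The indicator function `I_𝒦`. -/
noncomputable def indicatorK (X : L2) : EReal := if X ∈ coneK then 0 else ⊤

/-- The interaction energy `𝒲_Φ(X) = ½ ∬_{Ω × Ω} W_Φ(X(m) - X(ω)) dω dm`. -/
noncomputable def energyW (φ : ℝ → ℝ) (X : L2) : ℝ :=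
  (1 / 2) * ∫ m, ∫ ω, WPhi φ (X m - X ω) ∂mu ∂mu

/-- The functional `𝒱(X) = 𝒲_Φ(X) - ⟨Ψ, X⟩`. -/
noncomputable def potV (φ : ℝ → ℝ) (Ψ X : L2) : ℝ := energyW φ X - inner ℝ Ψ X

/-- The functional `𝒱 + I_𝒦`. -/
noncomputable def potVK (φ : ℝ → ℝ) (Ψ X : L2) : EReal := (potV φ Ψ X : EReal) + indicatorK X

/-- A functional with values in `(-∞, +∞]` that is finite somewhere. -/
def ProperFunctional (F : L2 → EReal) : Prop := (∀ X, F X ≠ ⊥) ∧ ∃ X, F X ≠ ⊤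

/-- Convexity of an extended real valued functional. -/
def ConvexFunctional (F : L2 → EReal) : Prop :=
  ∀ X Y : L2, ∀ θ : ℝ, 0 < θ → θ < 1 →
    F ((1 - θ) • X + θ • Y) ≤ ((1 - θ : ℝ) : EReal) * F X + (θ : EReal) * F Y

/-- The subdifferential `∂F(X)` of a proper functional. The inequality `F(Z) - F(X) ≥ ⟨Y, Z - X⟩`
is written without subtraction, so that `∂F(X)` is empty where `F(X) = +∞`. -/
def subdiff (F : L2 → EReal) (X : L2) : Set L2 :=
  {Y | ∀ Z : L2, F X + ((inner ℝ Y (Z - X) : ℝ) : EReal) ≤ F Z}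

/-- The minimal selection `∂°F(X)`: the elements of minimal norm of `∂F(X)`. -/
def minSubdiff (F : L2 → EReal) (X : L2) : Set L2 :=
  {Y | Y ∈ subdiff F X ∧ ∀ Z ∈ subdiff F X, ‖Y‖ ≤ ‖Z‖}

/-- The curve is absolutely continuous on every compact subinterval of `[0, ∞)`. Only the values
of `X` on `[0, ∞)` matter. -/
def LocallyAC (X : ℝ → L2) : Prop := ∀ T : ℝ, 0 ≤ T → AbsolutelyContinuousOnInterval X 0 T

/-- For a.e. `t > 0` the derivative of `X` at `t` exists and `-X'(t) ∈ A(X(t))`. -/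
def EvolvesBy (A : L2 → Set L2) (X : ℝ → L2) : Prop :=
  ∀ᵐ t : ℝ, 0 < t → ∃ v : L2, HasDerivAt X v t ∧ -v ∈ A (X t)

/-- An `L²`-gradient flow of `F`: an absolutely continuous curve `X : [0, ∞) → L²(Ω)` with
`-X'(t) ∈ ∂F(X(t))` for a.e. `t > 0`. -/
def IsGradientFlow (F : L2 → EReal) (X : ℝ → L2) : Prop :=
  LocallyAC X ∧ EvolvesBy (subdiff F) X

end EulerAlignment

/-! Since `φ ≥ 0`, its primitive `Φ` is nondecreasing and `W_Φ` is convex; as `Φ` is odd,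
integrating the tangent inequality of `W_Φ` over the square shows that `conv h X - Ψ` is a
subgradient of `potV` at every `X`. A function with a subgradient everywhere is convex and lower
semicontinuous, and the cone is closed and convex, so the rest is Hilbert space theory started at a
point of nonempty subdifferential.

Existence comes from the implicit Euler scheme with steps `2⁻ⁿ`. Monotonicity of the subdifferential
makes resolvents contractions and keeps the discrete speed below the norm of any initial
subgradient. Comparing one step with two half steps (`norm_sub_sq_le_of_halving`) makes the scheme
Cauchy, and the limit inherits the integrated evolution variational inequality (`limit_evi`).

Differentiability is not taken from a theorem on vector-valued Lipschitz curves. The minimal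
subgradient `a t` has nonincreasing norm, hence a norm continuous off a countable set. At a
continuity time the negated difference quotients nearly satisfy the subgradient inequality and are
hardly longer than `a t`, which forces them to converge to `a t` (`norm_sub_yosida_sq_le`,
`exists_gradientCurve`). Derivative and minimal selection thus come together. Uniqueness holds
because monotonicity makes the squared distance of two flows nonincreasing. -/

section ConstrainedSubdifferential

/-! ### Resolvents and Yosida approximations of a constrained convex functional. -/

open Filter Topology

variable {H : Type*} [NormedAddCommGroup H] [InnerProductSpace ℝ H]

/-- The subdifferential at `x` of the functional equal to `f` on `K` and to `+∞` elsewhere. -/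
def constrSubdiff (K : Set H) (f : H → ℝ) (x : H) : Set H :=
  {y | x ∈ K ∧ ∀ z ∈ K, f x + inner ℝ y (z - x) ≤ f z}

variable {K : Set H} {f : H → ℝ}

theorem constrSubdiff_monotone {x x' y y' : H} (hy : y ∈ constrSubdiff K f x)
    (hy' : y' ∈ constrSubdiff K f x') : 0 ≤ inner ℝ (y - y') (x - x') := by
  have h1 := hy.2 x' hy'.1
  have h2 := hy'.2 x hy.1
  have h3 : inner ℝ y (x' - x) = -inner ℝ y (x - x') := by
    rw [← inner_neg_right, neg_sub]
  rw [inner_sub_left]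
  linarith

theorem LowerSemicontinuousOn.le_of_tendsto {E : Type*} [TopologicalSpace E] {K : Set E}
    {f : E → ℝ} {ι : Type*} {l : Filter ι} [l.NeBot]
    (hf : LowerSemicontinuousOn f K) {x : E} (hx : x ∈ K) {u : ι → E} (hu : ∀ i, u i ∈ K)
    (hux : Tendsto u l (𝓝 x)) {c : ι → ℝ} {a : ℝ} (hc : Tendsto c l (𝓝 a))
    (hle : ∀ᶠ i in l, f (u i) ≤ c i) : f x ≤ a := by
  by_contra! hlt
  obtain ⟨b, hab, hbx⟩ := exists_between hlt
  have h1 : Tendsto u l (𝓝[K] x) :=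
    tendsto_nhdsWithin_iff.2 ⟨hux, Eventually.of_forall hu⟩
  have h2 := h1.eventually (hf x hx b hbx)
  have h3 := hc.eventually (gt_mem_nhds hab)
  obtain ⟨i, hi2, hi3, hi⟩ := (h2.and (h3.and hle)).exists
  exact absurd (hi2.trans_le hi) (not_lt.2 hi3.le)

/-- A minimizer of the proximal functional solves the resolvent equation. -/
theorem smul_sub_mem_constrSubdiff_of_isMinOn (hf : ConvexOn ℝ K f) {h : ℝ} {x z : H}
    (hz : z ∈ K) (hmin : IsMinOn (fun w => f w + (2 * h)⁻¹ * ‖w - x‖ ^ 2) K z) :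
    h⁻¹ • (x - z) ∈ constrSubdiff K f z := by
  refine ⟨hz, fun w hw => ?_⟩
  -- Compare `z` with a point at fraction `θ` of the segment to `w`; after division by `θ` the
  -- quadratic error still carries a factor `θ`, which is sent to `0`.
  have key : ∀ θ : ℝ, 0 < θ → θ ≤ 1 →
      f z + inner ℝ (h⁻¹ • (x - z)) (w - z) ≤ f w + θ * ((2 * h)⁻¹ * ‖w - z‖ ^ 2) := by
    intro θ h0 h1
    have hmem : (1 - θ) • z + θ • w ∈ K := hf.1 hz hw (by linarith) h0.le (by ring)
    have hconv := hf.2 hz hw (by linarith : 0 ≤ 1 - θ) h0.le (by ring)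
    have hm : f z + (2 * h)⁻¹ * ‖z - x‖ ^ 2 ≤
        f ((1 - θ) • z + θ • w) + (2 * h)⁻¹ * ‖(1 - θ) • z + θ • w - x‖ ^ 2 := hmin hmem
    have e1 : (1 - θ) • z + θ • w - x = (z - x) + θ • (w - z) := by module
    have e2 : ‖(z - x) + θ • (w - z)‖ ^ 2 =
        ‖z - x‖ ^ 2 + 2 * (θ * inner ℝ (z - x) (w - z)) + θ ^ 2 * ‖w - z‖ ^ 2 := by
      rw [norm_add_sq_real, inner_smul_right, norm_smul, mul_pow, Real.norm_eq_abs, sq_abs]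
    have e3 : inner ℝ (h⁻¹ • (x - z)) (w - z) = -(h⁻¹ * inner ℝ (z - x) (w - z)) := by
      rw [real_inner_smul_left, ← neg_sub z x, inner_neg_left]; ring
    rw [e1, e2] at hm
    simp only [smul_eq_mul] at hconv
    rw [e3]
    have e4 : (2 * h)⁻¹ = h⁻¹ / 2 := by rw [mul_inv]; ring
    rw [e4] at hm ⊢
    have : θ * (f z + -(h⁻¹ * inner ℝ (z - x) (w - z))) ≤
        θ * (f w + θ * (h⁻¹ / 2 * ‖w - z‖ ^ 2)) := by nlinarith
    exact le_of_mul_le_mul_left this h0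
  have hlim : Tendsto (fun θ : ℝ => f w + θ * ((2 * h)⁻¹ * ‖w - z‖ ^ 2)) (𝓝[>] 0)
      (𝓝 (f w + 0 * ((2 * h)⁻¹ * ‖w - z‖ ^ 2))) := by
    refine Tendsto.mono_left ?_ nhdsWithin_le_nhds
    exact Continuous.tendsto (by fun_prop) 0
  rw [zero_mul, add_zero] at hlim
  refine ge_of_tendsto hlim ?_
  filter_upwards [Ioc_mem_nhdsGT (zero_lt_one' ℝ)] with θ hθ using key θ hθ.1 hθ.2

/-- Solvability of the resolvent equation for the subdifferential. -/
theorem exists_resolvent [CompleteSpace H] (hK : IsClosed K) (hf : ConvexOn ℝ K f)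
    (hlsc : LowerSemicontinuousOn f K) {x₀ y₀ : H} (h₀ : y₀ ∈ constrSubdiff K f x₀) {h : ℝ}
    (hh : 0 < h) (x : H) : ∃ z, h⁻¹ • (x - z) ∈ constrSubdiff K f z := by
  set G : H → ℝ := fun w => f w + (2 * h)⁻¹ * ‖w - x‖ ^ 2 with hG
  have hc : 0 < (2 * h)⁻¹ := by positivity
  -- The affine minorant given by `y₀` is absorbed into the quadratic term by Young's inequality
  -- with weight `h`.
  have hbdd : BddBelow (G '' K) := by
    refine ⟨f x₀ + inner ℝ y₀ (x - x₀) - (h / 2) * ‖y₀‖ ^ 2, ?_⟩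
    rintro _ ⟨w, hw, rfl⟩
    have h1 := h₀.2 w hw
    have h2 : inner ℝ y₀ (w - x₀) = inner ℝ y₀ (w - x) + inner ℝ y₀ (x - x₀) := by
      rw [← inner_add_right]; congr 1; abel
    have h3 : -(‖y₀‖ * ‖w - x‖) ≤ inner ℝ y₀ (w - x) :=
      (abs_le.1 (abs_real_inner_le_norm y₀ (w - x))).1
    have h4 : ‖y₀‖ * ‖w - x‖ ≤ (h / 2) * ‖y₀‖ ^ 2 + (2 * h)⁻¹ * ‖w - x‖ ^ 2 := by
      have : (h / 2) * ‖y₀‖ ^ 2 + (2 * h)⁻¹ * ‖w - x‖ ^ 2 - ‖y₀‖ * ‖w - x‖ =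
          (2 * h)⁻¹ * (h * ‖y₀‖ - ‖w - x‖) ^ 2 := by field_simp; ring
      nlinarith [mul_nonneg hc.le (sq_nonneg (h * ‖y₀‖ - ‖w - x‖))]
    simp only [hG]
    linarith
  have hne : (G '' K).Nonempty := ⟨_, x₀, h₀.1, rfl⟩
  set m := sInf (G '' K) with hm
  have hlow : ∀ w ∈ K, m ≤ G w := fun w hw => csInf_le hbdd ⟨w, hw, rfl⟩
  have hex : ∀ n : ℕ, ∃ w ∈ K, G w < m + 1 / ((n : ℝ) + 1) := by
    intro n
    obtain ⟨_, ⟨w, hw, rfl⟩, hlt⟩ := exists_lt_of_csInf_lt hne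
      (lt_add_of_pos_right m (Nat.one_div_pos_of_nat (α := ℝ) (n := n)))
    exact ⟨w, hw, hlt⟩
  choose u huK hu using hex
  -- Strong convexity of `G`, from the parallelogram law at the midpoint: minimizing sequences are
  -- Cauchy, so no weak compactness is needed.
  have hpar : ∀ a ∈ K, ∀ b ∈ K, ‖a - b‖ ^ 2 ≤ 4 * h * ((G a - m) + (G b - m)) := by
    intro a ha b hb
    have hmem : (1 / 2 : ℝ) • a + (1 / 2 : ℝ) • b ∈ K :=
      hf.1 ha hb (by norm_num) (by norm_num) (by norm_num)
    have h1 := hf.2 ha hb (by norm_num : (0 : ℝ) ≤ 1 / 2) (by norm_num : (0 : ℝ) ≤ 1 / 2)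
      (by norm_num)
    have h2 := hlow _ hmem
    have e1 : (1 / 2 : ℝ) • a + (1 / 2 : ℝ) • b - x = (1 / 2 : ℝ) • ((a - x) + (b - x)) := by
      module
    have e2 := parallelogram_law_with_norm ℝ (a - x) (b - x)
    have e3 : a - x - (b - x) = a - b := by abel
    simp only [hG, e1, norm_smul, smul_eq_mul] at h1 h2 ⊢
    rw [e3] at e2
    rw [Real.norm_of_nonneg (by norm_num : (0 : ℝ) ≤ 1 / 2)] at h2
    have e4 : ‖a - b‖ ^ 2 = 2 * (‖a - x‖ ^ 2 + ‖b - x‖ ^ 2) - ‖a - x + (b - x)‖ ^ 2 := by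
      linarith
    have e5 : 4 * h * (h⁻¹ * 2⁻¹) = 2 := by field_simp; norm_num
    have e6 : (2 * h)⁻¹ = h⁻¹ * 2⁻¹ := by rw [mul_inv]; ring
    rw [e6] at h2 ⊢
    rw [mul_pow] at h2
    set c := h⁻¹ * 2⁻¹ with hcdef
    set p := ‖a - x‖ ^ 2
    set q := ‖b - x‖ ^ 2
    set r := ‖a - x + (b - x)‖ ^ 2
    rw [e4]
    have h3 : 2 * m ≤ f a + f b + c * r / 2 := by linarith
    have h4 : 4 * h * (2 * m) ≤ 4 * h * (f a + f b + c * r / 2) :=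
      mul_le_mul_of_nonneg_left h3 (by positivity)
    have e7 : 4 * h * (f a + c * p - m + (f b + c * q - m)) =
      4 * h * (f a + f b) + (4 * h * c) * (p + q) - 4 * h * (2 * m) := by ring
    have e8 : 4 * h * (f a + f b + c * r / 2) = 4 * h * (f a + f b) + (4 * h * c) * (r / 2) := by
      ring
    rw [e7, e5]
    rw [e8, e5] at h4
    linarith
  have hlim0 : Tendsto (fun n : ℕ => 1 / ((n : ℝ) + 1)) atTop (𝓝 0) :=
    tendsto_one_div_add_atTop_nhds_zero_nat
  have hcau : CauchySeq u := by
    refine cauchySeq_of_le_tendsto_0 (fun n : ℕ => Real.sqrt (8 * h * (1 / ((n : ℝ) + 1)))) ?_ ?_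
    · intro n k N hn hk
      rw [dist_eq_norm]
      refine Real.le_sqrt_of_sq_le ((hpar _ (huK n) _ (huK k)).trans ?_)
      have h1 : 1 / ((n : ℝ) + 1) ≤ 1 / ((N : ℝ) + 1) := Nat.one_div_le_one_div hn
      have h2 : 1 / ((k : ℝ) + 1) ≤ 1 / ((N : ℝ) + 1) := Nat.one_div_le_one_div hk
      have h3 := hu n
      have h4 := hu k
      have : (G (u n) - m) + (G (u k) - m) ≤ 2 * (1 / ((N : ℝ) + 1)) := by linarith
      nlinarith [mul_le_mul_of_nonneg_left this (by positivity : (0 : ℝ) ≤ 4 * h)]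
    · have := (hlim0.const_mul (8 * h)).sqrt
      simpa using this
  obtain ⟨z, hz⟩ := cauchySeq_tendsto_of_complete hcau
  have hzK : z ∈ K := hK.mem_of_tendsto hz (Eventually.of_forall huK)
  refine ⟨z, smul_sub_mem_constrSubdiff_of_isMinOn hf hzK fun w hw => ?_⟩
  have h1 : Tendsto (fun n : ℕ => m + 1 / ((n : ℝ) + 1) - (2 * h)⁻¹ * ‖u n - x‖ ^ 2) atTop
      (𝓝 (m + 0 - (2 * h)⁻¹ * ‖z - x‖ ^ 2)) :=
    (hlim0.const_add m).sub ((((hz.sub_const x).norm).pow 2).const_mul _)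
  have h2 := hlsc.le_of_tendsto hzK huK hz h1 (Eventually.of_forall fun n => by
    have := (hu n).le
    simp only [hG] at this
    linarith)
  have h3 := hlow w hw
  simp only [hG] at h3
  change f z + (2 * h)⁻¹ * ‖z - x‖ ^ 2 ≤ f w + (2 * h)⁻¹ * ‖w - x‖ ^ 2
  linarith

/-- `J h` solves the resolvent equation of the subdifferential for every step `h > 0`. -/
def IsResolvent (K : Set H) (f : H → ℝ) (J : ℝ → H → H) : Prop :=
  ∀ h, 0 < h → ∀ x, h⁻¹ • (x - J h x) ∈ constrSubdiff K f (J h x)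

theorem exists_isResolvent [CompleteSpace H] (hK : IsClosed K) (hf : ConvexOn ℝ K f)
    (hlsc : LowerSemicontinuousOn f K) {x₀ y₀ : H} (h₀ : y₀ ∈ constrSubdiff K f x₀) :
    ∃ J, IsResolvent K f J := by
  have : ∀ h : ℝ, ∀ x : H, ∃ z, 0 < h → h⁻¹ • (x - z) ∈ constrSubdiff K f z := by
    intro h x
    by_cases hh : 0 < h
    · obtain ⟨z, hz⟩ := exists_resolvent hK hf hlsc h₀ hh x
      exact ⟨z, fun _ => hz⟩
    · exact ⟨x, fun h' => absurd h' hh⟩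
  choose J hJ using this
  exact ⟨J, fun h hh x => hJ h x hh⟩

/-- The Yosida approximation attached to the resolvent `J`. -/
noncomputable def yosida (J : ℝ → H → H) (h : ℝ) (x : H) : H := h⁻¹ • (x - J h x)

namespace IsResolvent

variable {J : ℝ → H → H}

theorem yosida_mem (hJ : IsResolvent K f J) {h : ℝ} (hh : 0 < h) (x : H) :
    yosida J h x ∈ constrSubdiff K f (J h x) := hJ h hh x

theorem mem (hJ : IsResolvent K f J) {h : ℝ} (hh : 0 < h) (x : H) : J h x ∈ K := (hJ h hh x).1

theorem sub_eq_smul_yosida {h : ℝ} (hh : 0 < h) (x : H) : x - J h x = h • yosida J h x := by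
  rw [yosida, smul_inv_smul₀ hh.ne']

/-- Monotonicity gives `‖J h x - J h y‖² ≤ ⟨x - y, J h x - J h y⟩`; then apply Cauchy–Schwarz. -/
theorem norm_sub_le (hJ : IsResolvent K f J) {h : ℝ} (hh : 0 < h) (x y : H) :
    ‖J h x - J h y‖ ≤ ‖x - y‖ := by
  have h1 := constrSubdiff_monotone (hJ h hh x) (hJ h hh y)
  have e1 : h⁻¹ • (x - J h x) - h⁻¹ • (y - J h y) = h⁻¹ • ((x - y) - (J h x - J h y)) := by
    module
  rw [e1, real_inner_smul_left, inner_sub_left, real_inner_self_eq_norm_sq] at h1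
  have h2 := nonneg_of_mul_nonneg_right h1 (inv_pos.2 hh)
  have h3 := real_inner_le_norm (x - y) (J h x - J h y)
  by_contra! hlt
  nlinarith [norm_nonneg (x - y)]

/-- As `x - J h x` is `h` times the Yosida approximation `A`, monotonicity reads `⟨y - A, A⟩ ≥ 0`.
This is the source of all speed bounds and of minimality in the limit. -/
theorem norm_yosida_le (hJ : IsResolvent K f J) {h : ℝ} (hh : 0 < h) {x y : H}
    (hy : y ∈ constrSubdiff K f x) : ‖yosida J h x‖ ≤ ‖y‖ := by
  have h1 := constrSubdiff_monotone hy (hJ.yosida_mem hh x)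
  rw [sub_eq_smul_yosida hh, real_inner_smul_right, inner_sub_left,
    real_inner_self_eq_norm_sq] at h1
  have h2 := nonneg_of_mul_nonneg_right h1 hh
  have h3 := real_inner_le_norm y (yosida J h x)
  by_contra! hlt
  nlinarith [norm_nonneg y]

theorem continuous_yosida (hJ : IsResolvent K f J) {h : ℝ} (hh : 0 < h) :
    Continuous (yosida J h) := by
  have : LipschitzWith 1 (J h) := LipschitzWith.of_dist_le_mul fun x y => by
    simpa [dist_eq_norm] using hJ.norm_sub_le hh x y
  exact (continuous_id.sub this.continuous).const_smul _

/-- Expanding monotonicity gives `(h + k)‖A_h - A_k‖² ≤ (h - k)(‖A_k‖² - ‖A_h‖²)`, so convergence of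
the norms forces convergence of the vectors. -/
theorem norm_yosida_sub_sq_le (hJ : IsResolvent K f J) {h k : ℝ} (hk : 0 < k) (hkh : k ≤ h)
    (x : H) : ‖yosida J h x - yosida J k x‖ ^ 2 ≤ |‖yosida J k x‖ ^ 2 - ‖yosida J h x‖ ^ 2| := by
  have hh := hk.trans_le hkh
  have h1 := constrSubdiff_monotone (hJ.yosida_mem hh x) (hJ.yosida_mem hk x)
  have e1 : J h x - J k x = k • yosida J k x - h • yosida J h x := by
    rw [← sub_eq_smul_yosida hh, ← sub_eq_smul_yosida hk]; abel
  have e2 := norm_sub_sq_real (yosida J h x) (yosida J k x)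
  rw [e1, inner_sub_right, inner_sub_left, inner_sub_left, real_inner_smul_right,
    real_inner_smul_right, real_inner_smul_right, real_inner_smul_right,
    real_inner_self_eq_norm_sq, real_inner_self_eq_norm_sq,
    real_inner_comm (yosida J h x) (yosida J k x)] at h1
  set p := ‖yosida J h x‖ ^ 2
  set q := ‖yosida J k x‖ ^ 2
  set c := inner ℝ (yosida J h x) (yosida J k x)
  have h2 : (h + k) * (p - 2 * c + q) ≤ (h - k) * (q - p) := by linarith
  have h3 : (h - k) * (q - p) ≤ (h + k) * |q - p| :=
    mul_le_mul (by linarith) (le_abs_self _) (by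
      have h0 : 0 ≤ (h + k) * (p - 2 * c + q) := by rw [← e2]; positivity
      have : 0 ≤ (h - k) * (q - p) := h0.trans h2
      -- For `h = k` the factor `h - k` vanishes and says nothing about the sign of `q - p`, but
      -- then `p = q`.
      rcases hkh.eq_or_lt with rfl | hlt
      · have hpq : p = q := rfl
        rw [hpq, sub_self]
      · exact nonneg_of_mul_nonneg_right this (by linarith)) (by linarith)
  rw [e2]
  exact le_of_mul_le_mul_left (h2.trans h3) (by linarith)

theorem norm_yosida_anti (hJ : IsResolvent K f J) {h k : ℝ} (hk : 0 < k) (hkh : k ≤ h) (x : H) :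
    ‖yosida J h x‖ ≤ ‖yosida J k x‖ := by
  have hh := hk.trans_le hkh
  rcases hkh.eq_or_lt with rfl | hlt
  · rfl
  have h1 := constrSubdiff_monotone (hJ.yosida_mem hh x) (hJ.yosida_mem hk x)
  have e1 : J h x - J k x = k • yosida J k x - h • yosida J h x := by
    rw [← sub_eq_smul_yosida hh, ← sub_eq_smul_yosida hk]; abel
  have e2 := real_inner_le_norm (yosida J h x) (yosida J k x)
  rw [e1, inner_sub_right, inner_sub_left, inner_sub_left, real_inner_smul_right,
    real_inner_smul_right, real_inner_smul_right, real_inner_smul_right,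
    real_inner_self_eq_norm_sq, real_inner_self_eq_norm_sq,
    real_inner_comm (yosida J h x) (yosida J k x)] at h1
  by_contra! hlt'
  set p := ‖yosida J h x‖
  set q := ‖yosida J k x‖
  have hq : 0 ≤ q := norm_nonneg _
  have h4 : h * p ^ 2 + k * q ^ 2 ≤ (h + k) * (p * q) := by nlinarith
  have h5 : (p - q) * (h * p - k * q) ≤ 0 := by nlinarith
  have h6 : 0 < h * p - k * q := by nlinarith
  nlinarith [mul_pos (sub_pos.2 hlt') h6]

/-- If the Yosida approximations stay bounded at a point of `K`, they converge to an element of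
the subdifferential. -/
theorem exists_tendsto_yosida [CompleteSpace H] (hJ : IsResolvent K f J)
    (hlsc : LowerSemicontinuousOn f K) {x : H} (hx : x ∈ K) {c : ℝ}
    (hc : ∀ h, 0 < h → ‖yosida J h x‖ ≤ c) :
    ∃ y ∈ constrSubdiff K f x, ‖y‖ ≤ c ∧ (∀ z ∈ constrSubdiff K f x, ‖y‖ ≤ ‖z‖) ∧
      Tendsto (fun n : ℕ => yosida J (1 / ((n : ℝ) + 1)) x) atTop (𝓝 y) := by
  set s : ℕ → ℝ := fun n => 1 / ((n : ℝ) + 1) with hs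
  have hs0 : ∀ n, 0 < s n := fun n => Nat.one_div_pos_of_nat
  have hslim : Tendsto s atTop (𝓝 0) := tendsto_one_div_add_atTop_nhds_zero_nat
  have hanti : ∀ {n k : ℕ}, n ≤ k → s k ≤ s n := fun hnk => Nat.one_div_le_one_div hnk
  -- The norms grow as the step shrinks and stay below `c`, hence converge.
  have hmono : Monotone fun n => ‖yosida J (s n) x‖ := fun n k hnk =>
    hJ.norm_yosida_anti (hs0 k) (hanti hnk) x
  have hlim : Tendsto (fun n => ‖yosida J (s n) x‖ ^ 2) atTop
      (𝓝 ((⨆ n, ‖yosida J (s n) x‖) ^ 2)) :=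
    (tendsto_atTop_ciSup hmono ⟨c, by rintro _ ⟨n, rfl⟩; exact hc _ (hs0 n)⟩).pow 2
  have hcau : CauchySeq fun n => yosida J (s n) x := by
    rw [Metric.cauchySeq_iff']
    intro ε hε
    obtain ⟨N, hN⟩ := Metric.cauchySeq_iff'.1 hlim.cauchySeq (ε ^ 2) (by positivity)
    refine ⟨N, fun n hn => ?_⟩
    have h1 := hJ.norm_yosida_sub_sq_le (hs0 n) (hanti hn) x
    have h2 := hN n hn
    rw [Real.dist_eq] at h2
    rw [dist_eq_norm, norm_sub_rev]
    exact lt_of_pow_lt_pow_left₀ 2 hε.le (h1.trans_lt h2)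
  obtain ⟨y, hy⟩ := cauchySeq_tendsto_of_complete hcau
  have hJx : Tendsto (fun n => J (s n) x) atTop (𝓝 x) := by
    have h1 : Tendsto (fun n => x - s n • yosida J (s n) x) atTop (𝓝 (x - (0 : ℝ) • y)) :=
      tendsto_const_nhds.sub (hslim.smul hy)
    rw [zero_smul, sub_zero] at h1
    refine h1.congr fun n => ?_
    rw [← sub_eq_smul_yosida (hs0 n)]; abel
  refine ⟨y, ⟨hx, fun z hz => ?_⟩, le_of_tendsto hy.norm (Eventually.of_forall fun n =>
    hc _ (hs0 n)), fun z hz => le_of_tendsto hy.norm (Eventually.of_forall fun n =>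
    hJ.norm_yosida_le (hs0 n) hz), hy⟩
  have h1 : Tendsto (fun n => f z - inner ℝ (yosida J (s n) x) (z - J (s n) x)) atTop
      (𝓝 (f z - inner ℝ y (z - x))) :=
    tendsto_const_nhds.sub (hy.inner (tendsto_const_nhds.sub hJx))
  have h2 := hlsc.le_of_tendsto hx (fun n => hJ.mem (hs0 n) x) hJx h1
    (Eventually.of_forall fun n => by linarith [(hJ.yosida_mem (hs0 n) x).2 z hz])
  linarith

/-! ### Stability of the implicit Euler scheme. -/

theorem norm_iterate_sub_le (hJ : IsResolvent K f J) {h : ℝ} (hh : 0 < h) (k : ℕ) (x y : H) :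
    ‖(J h)^[k] x - (J h)^[k] y‖ ≤ ‖x - y‖ := by
  induction k with
  | zero => simp
  | succ k ih =>
    rw [Function.iterate_succ_apply', Function.iterate_succ_apply']
    exact (hJ.norm_sub_le hh _ _).trans ih

theorem iterate_mem (hJ : IsResolvent K f J) {h : ℝ} (hh : 0 < h) (k : ℕ) {x : H} (hx : x ∈ K) :
    (J h)^[k] x ∈ K := by
  cases k with
  | zero => simpa
  | succ k =>
    rw [Function.iterate_succ_apply']
    exact hJ.mem hh _

/-- The speed of the implicit Euler scheme is bounded by the initial one. -/
theorem norm_yosida_iterate_le (hJ : IsResolvent K f J) {h : ℝ} (hh : 0 < h) {x y : H}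
    (hy : y ∈ constrSubdiff K f x) (k : ℕ) : ‖yosida J h ((J h)^[k] x)‖ ≤ ‖y‖ := by
  induction k with
  | zero => exact hJ.norm_yosida_le hh hy
  | succ k ih =>
    rw [Function.iterate_succ_apply']
    exact (hJ.norm_yosida_le hh (hJ.yosida_mem hh _)).trans ih

/-- The parameter `l` is decoupled from the step `h` so that it can stay fixed while `h` tends to
`0`. -/
theorem norm_yosida_iterate_le' (hJ : IsResolvent K f J) {h l : ℝ} (hh : 0 < h) (hl : 0 < l)
    {x y : H} (hy : y ∈ constrSubdiff K f x) (k : ℕ) : ‖yosida J l ((J h)^[k] x)‖ ≤ ‖y‖ := by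
  cases k with
  | zero => exact hJ.norm_yosida_le hl hy
  | succ k =>
    rw [Function.iterate_succ_apply']
    exact (hJ.norm_yosida_le hl (hJ.yosida_mem hh _)).trans (hJ.norm_yosida_iterate_le hh hy k)

theorem norm_iterate_sub_self_le (hJ : IsResolvent K f J) {h : ℝ} (hh : 0 < h) {x y : H}
    (hy : y ∈ constrSubdiff K f x) (k : ℕ) : ‖(J h)^[k] x - x‖ ≤ k * h * ‖y‖ := by
  induction k with
  | zero => simp
  | succ k ih =>
    rw [Function.iterate_succ_apply']
    have h1 : ‖(J h)^[k] x - J h ((J h)^[k] x)‖ ≤ h * ‖y‖ := by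
      rw [sub_eq_smul_yosida hh, norm_smul, Real.norm_of_nonneg hh.le]
      exact mul_le_mul_of_nonneg_left (hJ.norm_yosida_iterate_le hh hy k) hh.le
    have h2 := norm_sub_le_norm_sub_add_norm_sub (J h ((J h)^[k] x)) ((J h)^[k] x) x
    rw [norm_sub_rev] at h1
    push_cast
    linarith

/-- One implicit Euler step compared with two steps of half the size. -/
theorem norm_sub_sq_le_of_halving (hJ : IsResolvent K f J) {h : ℝ} (hh : 0 < h) {x y : H} {L : ℝ}
    (ha : ‖yosida J h x‖ ≤ L) (hb : ‖yosida J (h / 2) y‖ ≤ L)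
    (hb' : ‖yosida J (h / 2) (J (h / 2) y)‖ ≤ L) :
    ‖J h x - J (h / 2) (J (h / 2) y)‖ ^ 2 ≤ ‖x - y‖ ^ 2 + 12 * h ^ 2 * L ^ 2 := by
  have hh2 : 0 < h / 2 := by linarith
  have hL : 0 ≤ L := (norm_nonneg _).trans ha
  have ea := sub_eq_smul_yosida (J := J) hh x
  have eb := sub_eq_smul_yosida (J := J) hh2 y
  have eb' := sub_eq_smul_yosida (J := J) hh2 (J (h / 2) y)
  have m1 := constrSubdiff_monotone (hJ.yosida_mem hh x) (hJ.yosida_mem hh2 y)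
  have m2 := constrSubdiff_monotone (hJ.yosida_mem hh x) (hJ.yosida_mem hh2 (J (h / 2) y))
  set a := yosida J h x
  set b := yosida J (h / 2) y
  set b' := yosida J (h / 2) (J (h / 2) y)
  set x' := J h x
  set y1 := J (h / 2) y
  set y2 := J (h / 2) y1
  have ex : x' = x - h • a := by rw [← ea]; abel
  have ey1 : y1 = y - (h / 2) • b := by rw [← eb]; abel
  have ey2 : y2 = y - (h / 2) • b - (h / 2) • b' := by rw [← ey1, ← eb']; abel
  have n1 : ‖a - b‖ ≤ 2 * L := (_root_.norm_sub_le _ _).trans (by linarith)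
  have n2 : ‖a - b'‖ ≤ 2 * L := (_root_.norm_sub_le _ _).trans (by linarith)
  -- Monotonicity controls the pairing at the end points; moving back to `x - y` costs `4hL²` for
  -- each half step. The two costs contribute `8h²L²` and the squared increment `4h²L²`, in total
  -- `12h²L²`.
  have key : ∀ u v : H, ‖u‖ ≤ 2 * L → ‖v‖ ≤ 2 * (h * L) → -(4 * h * L ^ 2) ≤ inner ℝ u v := by
    intro u v hu hv
    have h1 := (abs_le.1 (abs_real_inner_le_norm u v)).1
    have h2 := mul_le_mul hu hv (norm_nonneg v) (by linarith)
    linarith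
  have hnb : ‖(h / 2) • b‖ ≤ h / 2 * L := by
    rw [norm_smul, Real.norm_of_nonneg hh2.le]; exact mul_le_mul_of_nonneg_left hb hh2.le
  have hnb' : ‖(h / 2) • b'‖ ≤ h / 2 * L := by
    rw [norm_smul, Real.norm_of_nonneg hh2.le]; exact mul_le_mul_of_nonneg_left hb' hh2.le
  have hna : ‖h • a‖ ≤ h * L := by
    rw [norm_smul, Real.norm_of_nonneg hh.le]; exact mul_le_mul_of_nonneg_left ha hh.le
  have hhL : 0 ≤ h * L := by positivity
  have k1 : -(4 * h * L ^ 2) ≤ inner ℝ (a - b) (x - y) := by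
    have e : x - y = (x' - y1) + (h • a - (h / 2) • b) := by rw [ex, ey1]; abel
    rw [e, inner_add_right]
    have := key (a - b) (h • a - (h / 2) • b) n1 ((_root_.norm_sub_le _ _).trans (by linarith))
    linarith
  have k2 : -(4 * h * L ^ 2) ≤ inner ℝ (a - b') (x - y) := by
    have e : x - y = (x' - y2) + (h • a - ((h / 2) • b + (h / 2) • b')) := by rw [ex, ey2]; abel
    rw [e, inner_add_right]
    have h3 := norm_add_le ((h / 2) • b) ((h / 2) • b')
    have := key (a - b') (h • a - ((h / 2) • b + (h / 2) • b')) n2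
      ((_root_.norm_sub_le _ _).trans (by linarith))
    linarith
  have e : x' - y2 = (x - y) - (h / 2) • ((a - b) + (a - b')) := by rw [ex, ey2]; module
  have n3 : ‖(h / 2) • ((a - b) + (a - b'))‖ ≤ 2 * (h * L) := by
    rw [norm_smul, Real.norm_of_nonneg hh2.le]
    have := norm_add_le (a - b) (a - b')
    nlinarith
  rw [e, norm_sub_sq_real, real_inner_smul_right, inner_add_right,
    real_inner_comm (a - b), real_inner_comm (a - b')]
  have n4 : ‖(h / 2) • ((a - b) + (a - b'))‖ ^ 2 ≤ (2 * (h * L)) ^ 2 := by gcongr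
  nlinarith

theorem norm_iterate_sub_sq_le_of_halving (hJ : IsResolvent K f J) {h : ℝ} (hh : 0 < h) {x y : H}
    (hy : y ∈ constrSubdiff K f x) (k : ℕ) :
    ‖(J h)^[k] x - (J (h / 2))^[2 * k] x‖ ^ 2 ≤ 12 * k * h ^ 2 * ‖y‖ ^ 2 := by
  induction k with
  | zero => simp
  | succ k ih =>
    have hh2 : 0 < h / 2 := by linarith
    have hb := hJ.norm_yosida_iterate_le hh2 hy (2 * k + 1)
    rw [Function.iterate_succ_apply'] at hb
    have h1 := hJ.norm_sub_sq_le_of_halving hh (hJ.norm_yosida_iterate_le hh hy k)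
      (hJ.norm_yosida_iterate_le hh2 hy (2 * k)) hb
    rw [show 2 * (k + 1) = 2 * k + 1 + 1 by ring, Function.iterate_succ_apply',
      Function.iterate_succ_apply', Function.iterate_succ_apply']
    push_cast
    linarith

/-- Discrete evolution variational inequality for one step. -/
theorem step_evi (hJ : IsResolvent K f J) {h : ℝ} (hh : 0 < h) (x : H) {z : H} (hz : z ∈ K) :
    ‖J h x - z‖ ^ 2 - ‖x - z‖ ^ 2 ≤ 2 * h * (f z - f (J h x)) := by
  have h1 := (hJ.yosida_mem hh x).2 z hz
  have e : x - z = h • yosida J h x - (z - J h x) := by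
    rw [← sub_eq_smul_yosida hh]; abel
  rw [norm_sub_rev (J h x), e, norm_sub_sq_real (h • yosida J h x), real_inner_smul_left]
  nlinarith [sq_nonneg ‖h • yosida J h x‖]

theorem apply_le (hJ : IsResolvent K f J) {h : ℝ} (hh : 0 < h) {x : H} (hx : x ∈ K) :
    f (J h x) ≤ f x := by
  have h1 := hJ.step_evi hh x hx
  rw [sub_self, norm_zero] at h1
  have : 0 ≤ 2 * h * (f x - f (J h x)) := by nlinarith [sq_nonneg ‖J h x - x‖]
  linarith [nonneg_of_mul_nonneg_right this (by linarith)]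

/-- Discrete evolution variational inequality for several steps. -/
theorem iterate_evi (hJ : IsResolvent K f J) {h : ℝ} (hh : 0 < h) {x : H} (hx : x ∈ K) {z : H}
    (hz : z ∈ K) (k : ℕ) :
    ‖(J h)^[k] x - z‖ ^ 2 - ‖x - z‖ ^ 2 ≤ 2 * (k * h) * (f z - f ((J h)^[k] x)) := by
  induction k with
  | zero => simp
  | succ k ih =>
    rw [Function.iterate_succ_apply']
    have hk := hJ.iterate_mem hh k hx
    have h1 := hJ.step_evi hh ((J h)^[k] x) hz
    -- The energy decreases along the scheme, so earlier values may be replaced by the last one.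
    have h2 := mul_le_mul_of_nonneg_left (hJ.apply_le hh hk) (by positivity : 0 ≤ 2 * (k * h))
    push_cast
    linarith

end IsResolvent

end ConstrainedSubdifferential

/-! ### Convergence of the scheme and properties of the limit curve. -/

section GradientCurve

open Filter Topology

variable {H : Type*} [NormedAddCommGroup H] [InnerProductSpace ℝ H] {K : Set H} {f : H → ℝ}

/-- The implicit Euler scheme with step `2⁻ⁿ`, evaluated at time `t`. -/
noncomputable def dyadicEuler {E : Type*} (J : ℝ → E → E) (x : E) (n : ℕ) (t : ℝ) : E :=
  (J ((1 / 2) ^ n))^[⌊t * 2 ^ n⌋₊] x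

namespace IsResolvent

variable {J : ℝ → H → H}

/-- With elapsed time at most `t`, the halving defects sum to a squared distance of order `t * 2⁻ⁿ`;
rounding adds at most one half step. The resulting rate is geometric, hence summable. -/
theorem dist_dyadicEuler_succ_le (hJ : IsResolvent K f J) {x y : H} (hy : y ∈ constrSubdiff K f x)
    {t : ℝ} (ht : 0 ≤ t) (n : ℕ) :
    dist (dyadicEuler J x n t) (dyadicEuler J x (n + 1) t) ≤
      (Real.sqrt (12 * t) + 1) * ‖y‖ * Real.sqrt (1 / 2) ^ n := by
  obtain ⟨h, hh⟩ : ∃ h : ℝ, h = (1 / 2) ^ n := ⟨_, rfl⟩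
  obtain ⟨k, hk⟩ : ∃ k : ℕ, k = ⌊t * 2 ^ n⌋₊ := ⟨_, rfl⟩
  have h0 : 0 < h := by rw [hh]; positivity
  have h1 : (1 / 2 : ℝ) ^ (n + 1) = h / 2 := by rw [hh, pow_succ]; ring
  have hr2 : (Real.sqrt (1 / 2) ^ n) ^ 2 = h := by
    rw [← pow_mul, mul_comm, pow_mul, Real.sq_sqrt (by norm_num), hh]
  have hr0 : 0 ≤ Real.sqrt (1 / 2) ^ n := by positivity
  have hr1 : Real.sqrt (1 / 2) ^ n ≤ 1 :=
    pow_le_one₀ (Real.sqrt_nonneg _) (Real.sqrt_le_one.2 (by norm_num))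
  have hinv : (2 : ℝ) ^ n * h = 1 := by rw [hh, ← mul_pow]; norm_num
  have hkt : k * h ≤ t := by
    have := Nat.floor_le (by positivity : 0 ≤ t * 2 ^ n)
    rw [← hk] at this
    calc k * h ≤ t * 2 ^ n * h := by gcongr
      _ = t := by rw [mul_assoc, hinv, mul_one]
  set r := Real.sqrt (1 / 2) ^ n with hr
  have hmain : ‖(J h)^[k] x - (J (h / 2))^[2 * k] x‖ ≤ Real.sqrt (12 * t) * r * ‖y‖ := by
    have hsq := hJ.norm_iterate_sub_sq_le_of_halving h0 hy k
    refine (pow_le_pow_iff_left₀ (norm_nonneg _) (by positivity) two_ne_zero).1 (hsq.trans ?_)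
    rw [mul_pow, mul_pow, Real.sq_sqrt (by positivity), hr2]
    have : 12 * (k * h) * (h * ‖y‖ ^ 2) ≤ 12 * t * (h * ‖y‖ ^ 2) := by gcongr
    linarith
  have hfl : ⌊t * 2 ^ (n + 1)⌋₊ = 2 * k ∨ ⌊t * 2 ^ (n + 1)⌋₊ = 2 * k + 1 := by
    have e : t * 2 ^ (n + 1) = 2 * (t * 2 ^ n) := by ring
    have a1 := Nat.floor_le (by positivity : 0 ≤ t * 2 ^ n)
    have a2 := Nat.lt_floor_add_one (t * 2 ^ n)
    rw [← hk] at a1 a2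
    have b1 : 2 * k ≤ ⌊t * 2 ^ (n + 1)⌋₊ := Nat.le_floor (by push_cast; linarith)
    have b2 : ⌊t * 2 ^ (n + 1)⌋₊ < 2 * k + 2 :=
      (Nat.floor_lt (by positivity)).2 (by push_cast; linarith)
    lia
  have hrh : h / 2 ≤ r := by nlinarith
  rw [dyadicEuler, dyadicEuler, h1, ← hh, ← hk, dist_eq_norm]
  have hyr : h / 2 * ‖y‖ ≤ r * ‖y‖ := by gcongr
  rcases hfl with e | e
  · rw [e]
    have : 0 ≤ r * ‖y‖ := by positivity
    linarith
  · rw [e, Function.iterate_succ_apply']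
    have hs : ‖(J (h / 2))^[2 * k] x - J (h / 2) ((J (h / 2))^[2 * k] x)‖ ≤ h / 2 * ‖y‖ := by
      rw [sub_eq_smul_yosida (by linarith), norm_smul, Real.norm_of_nonneg (by linarith)]
      exact mul_le_mul_of_nonneg_left (hJ.norm_yosida_iterate_le (by linarith) hy _) (by linarith)
    have := norm_sub_le_norm_sub_add_norm_sub ((J h)^[k] x) ((J (h / 2))^[2 * k] x)
      (J (h / 2) ((J (h / 2))^[2 * k] x))
    linarith

theorem exists_tendsto_dyadicEuler [CompleteSpace H] (hJ : IsResolvent K f J) {x y : H}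
    (hy : y ∈ constrSubdiff K f x) :
    ∃ u : ℝ → H, ∀ t, 0 ≤ t → Tendsto (fun n => dyadicEuler J x n t) atTop (𝓝 (u t)) := by
  have : ∀ t : ℝ, ∃ z : H, 0 ≤ t → Tendsto (fun n => dyadicEuler J x n t) atTop (𝓝 z) := by
    intro t
    by_cases ht : 0 ≤ t
    · obtain ⟨z, hz⟩ := cauchySeq_tendsto_of_complete
        (cauchySeq_of_le_geometric _ _ ((Real.sqrt_lt' one_pos).2 (by norm_num))
          (hJ.dist_dyadicEuler_succ_le hy ht))
      exact ⟨z, fun _ => hz⟩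
    · exact ⟨0, fun h => absurd h ht⟩
  choose u hu using this
  exact ⟨u, hu⟩

end IsResolvent

/-- Substitute for the semigroup property: the scheme is restarted at `s`, with an elapsed time that
equals `t - s` only in the limit. -/
theorem exists_dyadicEuler_eq_iterate {E : Type*} (J : ℝ → E → E) (x : E) {s t : ℝ} (hs : 0 ≤ s)
    (hst : s ≤ t) :
    ∃ l : ℕ → ℕ, (∀ n, dyadicEuler J x n t = (J ((1 / 2) ^ n))^[l n] (dyadicEuler J x n s)) ∧
      Tendsto (fun n => l n * (1 / 2 : ℝ) ^ n) atTop (𝓝 (t - s)) := by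
  refine ⟨fun n => ⌊t * 2 ^ n⌋₊ - ⌊s * 2 ^ n⌋₊, fun n => ?_, ?_⟩
  · have : ⌊s * 2 ^ n⌋₊ ≤ ⌊t * 2 ^ n⌋₊ := Nat.floor_mono (by gcongr)
    rw [dyadicEuler, dyadicEuler, ← Function.iterate_add_apply, Nat.sub_add_cancel this]
  · have hp : Tendsto (fun n : ℕ => (2 : ℝ) ^ n) atTop atTop :=
      tendsto_pow_atTop_atTop_of_one_lt one_lt_two
    have h1 := (tendsto_nat_floor_mul_div_atTop (hs.trans hst)).comp hp
    have h2 := (tendsto_nat_floor_mul_div_atTop hs).comp hp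
    refine (h1.sub h2).congr fun n => ?_
    have : ⌊s * 2 ^ n⌋₊ ≤ ⌊t * 2 ^ n⌋₊ := Nat.floor_mono (by gcongr)
    rw [Nat.cast_sub this]
    simp [div_eq_mul_inv, sub_mul]

namespace IsResolvent

variable {J : ℝ → H → H} {x : H} {u : ℝ → H}

theorem limit_mem (hJ : IsResolvent K f J) (hK : IsClosed K) (hx : x ∈ K)
    (hu : ∀ t, 0 ≤ t → Tendsto (fun n => dyadicEuler J x n t) atTop (𝓝 (u t))) {t : ℝ}
    (ht : 0 ≤ t) : u t ∈ K :=
  hK.mem_of_tendsto (hu t ht)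
    (Eventually.of_forall fun n => hJ.iterate_mem (by positivity) _ hx)

/-- The evolution variational inequality in integrated form. -/
theorem limit_evi (hJ : IsResolvent K f J) (hK : IsClosed K) (hlsc : LowerSemicontinuousOn f K)
    (hx : x ∈ K) (hu : ∀ t, 0 ≤ t → Tendsto (fun n => dyadicEuler J x n t) atTop (𝓝 (u t)))
    {s t : ℝ} (hs : 0 ≤ s) (hst : s < t) {z : H} (hz : z ∈ K) :
    ‖u t - z‖ ^ 2 - ‖u s - z‖ ^ 2 ≤ 2 * (t - s) * (f z - f (u t)) := by
  obtain ⟨l, hl, hlim⟩ := exists_dyadicEuler_eq_iterate J x hs hst.le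
  have ht := hs.trans hst.le
  have hd : 0 < t - s := sub_pos.2 hst
  have h1 : Tendsto (fun n => f z - (‖dyadicEuler J x n t - z‖ ^ 2 - ‖dyadicEuler J x n s - z‖ ^ 2)
      / (2 * (l n * (1 / 2 : ℝ) ^ n))) atTop
      (𝓝 (f z - (‖u t - z‖ ^ 2 - ‖u s - z‖ ^ 2) / (2 * (t - s)))) :=
    tendsto_const_nhds.sub ((((((hu t ht).sub_const z).norm).pow 2).sub
      (((hu s hs).sub_const z).norm.pow 2)).div (hlim.const_mul 2) (by positivity))
  -- Lower semicontinuity passes only upper bounds on `f` to the limit, so the discrete inequality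
  -- is first solved for `f` at time `t`.
  have hev : ∀ᶠ n in atTop, f (dyadicEuler J x n t) ≤
      f z - (‖dyadicEuler J x n t - z‖ ^ 2 - ‖dyadicEuler J x n s - z‖ ^ 2)
      / (2 * (l n * (1 / 2 : ℝ) ^ n)) := by
    filter_upwards [hlim.eventually (lt_mem_nhds hd)] with n hn
    have h2 := hJ.iterate_evi (by positivity : (0 : ℝ) < (1 / 2) ^ n)
      (hJ.iterate_mem (by positivity : (0 : ℝ) < (1 / 2) ^ n) ⌊s * 2 ^ n⌋₊ hx) hz (l n)
    change ‖(J ((1 / 2) ^ n))^[l n] (dyadicEuler J x n s) - z‖ ^ 2 -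
      ‖dyadicEuler J x n s - z‖ ^ 2 ≤ 2 * (l n * (1 / 2) ^ n) *
      (f z - f ((J ((1 / 2) ^ n))^[l n] (dyadicEuler J x n s))) at h2
    rw [← hl, mul_comm] at h2
    have := (div_le_iff₀ (by positivity : 0 < 2 * (l n * (1 / 2 : ℝ) ^ n))).2 h2
    linarith
  have h3 := hlsc.le_of_tendsto (hJ.limit_mem hK hx hu ht)
    (fun n => hJ.iterate_mem (by positivity) _ hx) (hu t ht) h1 hev
  have h4 : (‖u t - z‖ ^ 2 - ‖u s - z‖ ^ 2) / (2 * (t - s)) ≤ f z - f (u t) := by linarith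
  rw [div_le_iff₀ (by positivity)] at h4
  linarith

/-- Restart the scheme at `u s`, where `y` bounds the speed; contraction makes the mismatch with the
original scheme negligible. -/
theorem norm_limit_sub_le (hJ : IsResolvent K f J)
    (hu : ∀ t, 0 ≤ t → Tendsto (fun n => dyadicEuler J x n t) atTop (𝓝 (u t)))
    {s t : ℝ} (hs : 0 ≤ s) (hst : s ≤ t) {y : H} (hy : y ∈ constrSubdiff K f (u s)) :
    ‖u t - u s‖ ≤ (t - s) * ‖y‖ := by
  obtain ⟨l, hl, hlim⟩ := exists_dyadicEuler_eq_iterate J x hs hst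
  have h1 : Tendsto (fun n => ‖dyadicEuler J x n s - u s‖ + l n * (1 / 2 : ℝ) ^ n * ‖y‖) atTop
      (𝓝 (‖u s - u s‖ + (t - s) * ‖y‖)) :=
    (((hu s hs).sub_const _).norm).add (hlim.mul_const _)
  rw [sub_self, norm_zero, zero_add] at h1
  refine le_of_tendsto_of_tendsto' ((hu t (hs.trans hst)).sub_const (u s)).norm h1 fun n => ?_
  have hh : (0 : ℝ) < (1 / 2) ^ n := by positivity
  have h2 := hJ.norm_iterate_sub_le hh (l n) (dyadicEuler J x n s) (u s)
  have h3 := hJ.norm_iterate_sub_self_le hh hy (l n)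
  have h4 := norm_sub_le_norm_sub_add_norm_sub ((J ((1 / 2) ^ n))^[l n] (dyadicEuler J x n s))
    ((J ((1 / 2) ^ n))^[l n] (u s)) (u s)
  rw [hl]
  linarith

/-- The same restart bounds the Yosida approximations at later times: at `s = 0` this yields
subgradients at every time, and for general `s` the decay of their minimal norm. -/
theorem norm_yosida_limit_le (hJ : IsResolvent K f J)
    (hu : ∀ t, 0 ≤ t → Tendsto (fun n => dyadicEuler J x n t) atTop (𝓝 (u t)))
    {s t : ℝ} (hs : 0 ≤ s) (hst : s ≤ t) {y : H} (hy : y ∈ constrSubdiff K f (u s)) {h : ℝ}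
    (hh : 0 < h) : ‖yosida J h (u t)‖ ≤ ‖y‖ := by
  obtain ⟨l, hl, -⟩ := exists_dyadicEuler_eq_iterate J x hs hst
  have h1 : Tendsto (fun n => (J ((1 / 2) ^ n))^[l n] (u s)) atTop (𝓝 (u t)) := by
    have h2 : Tendsto (fun n => (J ((1 / 2) ^ n))^[l n] (u s) - dyadicEuler J x n t) atTop
        (𝓝 0) := by
      have h3 := ((hu s hs).const_sub (u s)).norm
      rw [sub_self, norm_zero] at h3
      refine squeeze_zero_norm (fun n => ?_) h3
      rw [hl]
      exact hJ.norm_iterate_sub_le (by positivity) _ _ _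
    simpa using h2.add (hu t (hs.trans hst))
  exact le_of_tendsto (((hJ.continuous_yosida hh).tendsto _).comp h1).norm
    (Eventually.of_forall fun n => hJ.norm_yosida_iterate_le' (by positivity) hh hy _)

/-- Vectors that nearly satisfy the subgradient inequality at `x`, and are not much longer than
the Yosida approximation, are close to it. -/
theorem norm_sub_yosida_sq_le (hJ : IsResolvent K f J) {h : ℝ} (hh : 0 < h) (hx : x ∈ K)
    {q p b : H} {G δ : ℝ} (hq : ‖q‖ ≤ G)
    (hsub : inner ℝ q (J h x - p) ≤ f (J h x) - f b) (hb : f x - δ ≤ f b) :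
    ‖q - yosida J h x‖ ^ 2 ≤ G ^ 2 - ‖yosida J h x‖ ^ 2 + 2 / h * (δ + G * ‖x - p‖) := by
  have h1 := (hJ.yosida_mem hh x).2 x hx
  have e : J h x - p = (x - p) - h • yosida J h x := by
    rw [← sub_eq_smul_yosida hh]; abel
  rw [sub_eq_smul_yosida hh, real_inner_smul_right, real_inner_self_eq_norm_sq] at h1
  rw [e, inner_sub_right, real_inner_smul_right] at hsub
  have h2 := (abs_le.1 (abs_real_inner_le_norm q (x - p))).1
  have h3 : ‖q‖ * ‖x - p‖ ≤ G * ‖x - p‖ := by gcongr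
  have h4 : ‖q‖ ^ 2 ≤ G ^ 2 := by gcongr
  -- Adding the two subgradient inequalities cancels the values of `f` up to `δ`.
  have h5 : h * (‖yosida J h x‖ ^ 2 - inner ℝ q (yosida J h x)) ≤ δ + G * ‖x - p‖ := by linarith
  have h6 : ‖yosida J h x‖ ^ 2 - inner ℝ q (yosida J h x) ≤ (δ + G * ‖x - p‖) / h := by
    rw [le_div_iff₀ hh]; linarith
  rw [norm_sub_sq_real]
  have e2 : 2 / h * (δ + G * ‖x - p‖) = 2 * ((δ + G * ‖x - p‖) / h) := by ring
  rw [e2]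
  linarith

end IsResolvent

/-! ### Differentiability, minimal selection and uniqueness. -/

/-- A difference of squared distances to `z` is twice the pairing of the increment with the midpoint
minus `z`. The variational inequality thus becomes a subgradient inequality for the negated slope,
based at the midpoint. -/
theorem inner_slope_le_of_evi {u : ℝ → H} {a b c : ℝ} (hab : a < b) {z : H}
    (h : ‖u b - z‖ ^ 2 - ‖u a - z‖ ^ 2 ≤ 2 * (b - a) * c) :
    inner ℝ (-slope u a b) (z - (1 / 2 : ℝ) • (u a + u b)) ≤ c := by
  have hd : 0 < b - a := sub_pos.2 hab
  have e : ‖u b - z‖ ^ 2 - ‖u a - z‖ ^ 2 =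
      2 * (b - a) * inner ℝ (-slope u a b) (z - (1 / 2 : ℝ) • (u a + u b)) := by
    have e1 : u b - z = (u b - u a) + (u a - z) := by abel
    have e2 : -slope u a b = -((b - a)⁻¹ • (u b - u a)) := by rw [slope_def_module]
    have e3 : z - (1 / 2 : ℝ) • (u a + u b) = -((1 / 2 : ℝ) • (u b - u a) + (u a - z)) := by
      module
    rw [e2, e3, inner_neg_neg, real_inner_smul_left, inner_add_right, real_inner_smul_right,
      real_inner_self_eq_norm_sq, e1, norm_add_sq_real]
    field_simp
    ring
  rw [e] at h
  exact le_of_mul_le_mul_left h (by positivity)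

/-- The gradient flow of a convex lower semicontinuous functional on a closed convex set, started
at a point of nonempty subdifferential: it is Lipschitz and follows the minimal selection. -/
theorem exists_gradientCurve [CompleteSpace H] (hK : IsClosed K) (hf : ConvexOn ℝ K f)
    (hlsc : LowerSemicontinuousOn f K) {x y : H} (hy : y ∈ constrSubdiff K f x) :
    ∃ u : ℝ → H, u 0 = x ∧ (∀ t, 0 ≤ t → u t ∈ K) ∧
      (∀ s t, 0 ≤ s → s ≤ t → ‖u t - u s‖ ≤ (t - s) * ‖y‖) ∧
      ∀ᵐ t : ℝ, 0 < t → ∃ v, HasDerivAt u v t ∧ -v ∈ constrSubdiff K f (u t) ∧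
        ∀ w ∈ constrSubdiff K f (u t), ‖v‖ ≤ ‖w‖ := by
  obtain ⟨J, hJ⟩ := exists_isResolvent hK hf hlsc hy
  obtain ⟨u, hu⟩ := hJ.exists_tendsto_dyadicEuler hy
  have hu0 : u 0 = x := by
    have h1 := hu 0 le_rfl
    have h2 : (fun n => dyadicEuler J x n 0) = fun _ => x := by
      funext n; simp [dyadicEuler]
    rw [h2] at h1
    exact tendsto_nhds_unique h1 tendsto_const_nhds
  have hmem : ∀ t, 0 ≤ t → u t ∈ K := fun t ht => hJ.limit_mem hK hy.1 hu ht
  have hy0 : y ∈ constrSubdiff K f (u 0) := by rwa [hu0]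
  have hmin : ∀ t : ℝ, ∃ a : H, 0 ≤ t → a ∈ constrSubdiff K f (u t) ∧ ‖a‖ ≤ ‖y‖ ∧
      (∀ w ∈ constrSubdiff K f (u t), ‖a‖ ≤ ‖w‖) ∧
      Tendsto (fun n : ℕ => yosida J (1 / ((n : ℝ) + 1)) (u t)) atTop (𝓝 a) := by
    intro t
    by_cases ht : 0 ≤ t
    · obtain ⟨a, ha⟩ := hJ.exists_tendsto_yosida hlsc (hmem t ht)
        (fun h hh => hJ.norm_yosida_limit_le hu le_rfl ht hy0 hh)
      exact ⟨a, fun _ => ha⟩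
    · exact ⟨0, fun h => absurd h ht⟩
  choose a ha using hmin
  have hanti' : ∀ s t, 0 ≤ s → s ≤ t → ‖a t‖ ≤ ‖a s‖ := by
    intro s t hs hst
    have h1 := (ha t (hs.trans hst)).2.2.2.norm
    exact le_of_tendsto h1 (Eventually.of_forall fun n =>
      hJ.norm_yosida_limit_le hu hs hst (ha s hs).1 Nat.one_div_pos_of_nat)
  have hlip : ∀ s t, 0 ≤ s → s ≤ t → ‖u t - u s‖ ≤ (t - s) * ‖a s‖ := fun s t hs hst =>
    hJ.norm_limit_sub_le hu hs hst (ha s hs).1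
  have hlip' : ∀ s t, 0 ≤ s → s ≤ t → ‖u t - u s‖ ≤ (t - s) * ‖y‖ := fun s t hs hst =>
    (hlip s t hs hst).trans (mul_le_mul_of_nonneg_left (ha s hs).2.1 (by linarith))
  refine ⟨u, hu0, hmem, hlip', ?_⟩
  -- Freezing negative times makes `g` antitone on the whole line, hence continuous off a countable
  -- set.
  set g : ℝ → ℝ := fun t => ‖a (max t 0)‖ with hg
  have hganti : Antitone g := fun s t hst =>
    hanti' _ _ (le_max_right _ _) (max_le_max_right _ hst)
  filter_upwards [hganti.countable_not_continuousAt.ae_notMem volume] with t htc ht0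
  have hgc : ContinuousAt g t := by simpa using htc
  have hgt : g t = ‖a t‖ := by simp [hg, ht0.le]
  have hat := ha t ht0.le
  refine ⟨-a t, ?_, by simpa using hat.1, by simpa using hat.2.2.1⟩
  have hcont : ContinuousAt u t := by
    rw [Metric.continuousAt_iff']
    intro ε hε
    have h1 : Tendsto (fun s => |s - t| * ‖y‖) (𝓝 t) (𝓝 (|t - t| * ‖y‖)) :=
      Continuous.tendsto (by fun_prop) t
    rw [sub_self, abs_zero, zero_mul] at h1
    filter_upwards [h1.eventually (gt_mem_nhds hε), lt_mem_nhds ht0] with s hs hs0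
    refine lt_of_le_of_lt ?_ hs
    rw [dist_eq_norm]
    rcases le_total s t with hst | hst
    · rw [norm_sub_rev, abs_sub_comm, abs_of_nonneg (sub_nonneg.2 hst)]
      exact hlip' s t hs0.le hst
    · rw [abs_of_nonneg (sub_nonneg.2 hst)]
      exact hlip' t s ht0.le hst
  -- The length of a slope is controlled at the earlier time, the energy at the later one. For left
  -- slopes the length bound is `g s` rather than `g t`, whence the need for continuity of `g`.
  have hslope : ∀ s, 0 < s → s ≠ t → ‖-slope u t s‖ ≤ g (min s t) ∧ ∀ z ∈ K,
      inner ℝ (-slope u t s) (z - (1 / 2 : ℝ) • (u t + u s)) ≤ f z - f (u (max s t)) := by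
    have aux : ∀ a' b', 0 < a' → a' < b' → ‖-slope u a' b'‖ ≤ g a' := by
      intro a' b' h0 hab
      have hd : 0 < b' - a' := sub_pos.2 hab
      have h1 := hlip a' b' h0.le hab.le
      rw [norm_neg, slope_def_module, norm_smul, norm_inv, Real.norm_of_nonneg hd.le,
        inv_mul_le_iff₀ hd]
      simpa [hg, h0.le] using h1
    intro s hs hne
    rcases lt_or_gt_of_ne hne with hst | hst
    · rw [min_eq_left hst.le, max_eq_right hst.le, slope_comm, add_comm (u t)]
      exact ⟨aux s t hs hst, fun z hz =>
        inner_slope_le_of_evi hst (hJ.limit_evi hK hlsc hy.1 hu hs.le hst hz)⟩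
    · rw [min_eq_right hst.le, max_eq_left hst.le]
      exact ⟨aux t s ht0 hst, fun z hz =>
        inner_slope_le_of_evi hst (hJ.limit_evi hK hlsc hy.1 hu ht0.le hst hz)⟩
  rw [hasDerivAt_iff_tendsto_slope, Metric.tendsto_nhds]
  intro ε hε
  have hyos := hat.2.2.2
  have hgap : Tendsto (fun n : ℕ => ‖a t‖ ^ 2 - ‖yosida J (1 / ((n : ℝ) + 1)) (u t)‖ ^ 2) atTop
      (𝓝 (‖a t‖ ^ 2 - ‖a t‖ ^ 2)) := tendsto_const_nhds.sub (hyos.norm.pow 2)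
  rw [sub_self] at hgap
  obtain ⟨n, hn1, hn2⟩ := ((hgap.eventually (gt_mem_nhds (by positivity : 0 < (ε / 2) ^ 2))).and
    (Metric.tendsto_nhds.1 hyos (ε / 2) (by positivity))).exists
  obtain ⟨h, hh⟩ : ∃ h : ℝ, h = 1 / ((n : ℝ) + 1) := ⟨_, rfl⟩
  have h0 : 0 < h := hh ▸ Nat.one_div_pos_of_nat
  rw [← hh] at hn1 hn2
  -- `η` is the slack left in `(ε / 2) ^ 2` by the norm gap of the Yosida approximation. An energy
  -- defect `h * η / 4` spends half of it after multiplication by `2 / h`; the other error terms get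
  -- the rest.
  obtain ⟨η, hη⟩ : ∃ η, η = (ε / 2) ^ 2 - (‖a t‖ ^ 2 - ‖yosida J h (u t)‖ ^ 2) := ⟨_, rfl⟩
  have hη0 : 0 < η := by linarith
  have hgmin : ContinuousAt (fun s => g (min s t)) t := by
    refine ContinuousAt.comp (f := fun s => min s t) (g := g) ?_ (by fun_prop)
    simpa using hgc
  have humax : ContinuousAt (fun s => u (max s t)) t := by
    refine ContinuousAt.comp (f := fun s => max s t) (g := u) ?_ (by fun_prop)
    simpa using hcont
  have hR : Tendsto (fun s => g (min s t) ^ 2 - ‖a t‖ ^ 2 +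
      2 / h * (g (min s t) * ‖u t - (1 / 2 : ℝ) • (u t + u s)‖)) (𝓝 t)
      (𝓝 (g (min t t) ^ 2 - ‖a t‖ ^ 2 +
        2 / h * (g (min t t) * ‖u t - (1 / 2 : ℝ) • (u t + u t)‖))) :=
    ((hgmin.pow 2).sub_const _).add ((hgmin.mul
      ((hcont.const_add (u t)).const_smul (1 / 2 : ℝ) |>.const_sub (u t)).norm).const_mul _)
  have e0 : u t - (1 / 2 : ℝ) • (u t + u t) = 0 := by module
  rw [min_self, hgt, e0, norm_zero, mul_zero, mul_zero, sub_self, add_zero] at hR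
  have hfl : ∀ᶠ s in 𝓝 t, f (u t) - h * η / 4 < f (u (max s t)) := by
    have h1 : Tendsto (fun s => u (max s t)) (𝓝 t) (𝓝[K] (u t)) := by
      refine tendsto_nhdsWithin_iff.2 ⟨by simpa [ContinuousAt] using humax,
        Eventually.of_forall fun s => hmem _ (ht0.le.trans (le_max_right _ _))⟩
    exact h1.eventually (hlsc _ (hmem t ht0.le) (f (u t) - h * η / 4)
      (by have := mul_pos h0 hη0; change f (u t) > _; linarith))
  filter_upwards [nhdsWithin_le_nhds (hR.eventually (gt_mem_nhds (half_pos hη0))),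
    nhdsWithin_le_nhds hfl, nhdsWithin_le_nhds (lt_mem_nhds ht0), self_mem_nhdsWithin]
    with s hs1 hs2 hs3 hs4
  obtain ⟨hq1, hq2⟩ := hslope s hs3 hs4
  have hfin := hJ.norm_sub_yosida_sq_le h0 (hmem t ht0.le) hq1 (hq2 _ (hJ.mem h0 _)) hs2.le
  have e1 : 2 / h * (h * η / 4 + g (min s t) * ‖u t - (1 / 2 : ℝ) • (u t + u s)‖) =
      η / 2 + 2 / h * (g (min s t) * ‖u t - (1 / 2 : ℝ) • (u t + u s)‖) := by
    field_simp; ring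
  rw [e1] at hfin
  have h3 : ‖-slope u t s - yosida J h (u t)‖ < ε / 2 :=
    lt_of_pow_lt_pow_left₀ 2 (by positivity) (by linarith)
  rw [dist_eq_norm] at hn2
  have h4 := norm_sub_le_norm_sub_add_norm_sub (-slope u t s) (yosida J h (u t)) (a t)
  rw [dist_eq_norm, ← norm_neg]
  have e2 : -(slope u t s - -a t) = -slope u t s - a t := by abel
  rw [e2]
  linarith

theorem AbsolutelyContinuousOnInterval.norm {E : Type*} [SeminormedAddCommGroup E] {w : ℝ → E}
    {a b : ℝ} (hw : AbsolutelyContinuousOnInterval w a b) :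
    AbsolutelyContinuousOnInterval (fun t => ‖w t‖) a b :=
  squeeze_zero (fun _ => Finset.sum_nonneg fun _ _ => dist_nonneg)
    (fun _ => Finset.sum_le_sum fun _ _ => by
      rw [Real.dist_eq, dist_eq_norm]; exact abs_norm_sub_norm_le _ _) hw

/-- Absolutely continuous curves that evolve by a monotone operator are determined by their
initial value. -/
theorem eq_of_evolves_by_monotone {A : H → Set H}
    (hA : ∀ x x' y y', y ∈ A x → y' ∈ A x' → 0 ≤ inner ℝ (y - y') (x - x')) {X Y : ℝ → H} {T : ℝ}
    (hT : 0 ≤ T) (hX : AbsolutelyContinuousOnInterval X 0 T)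
    (hY : AbsolutelyContinuousOnInterval Y 0 T)
    (hX' : ∀ᵐ t : ℝ, 0 < t → ∃ v, HasDerivAt X v t ∧ -v ∈ A (X t))
    (hY' : ∀ᵐ t : ℝ, 0 < t → ∃ v, HasDerivAt Y v t ∧ -v ∈ A (Y t)) (h0 : X 0 = Y 0) :
    X T = Y T := by
  -- The squared distance is a scalar absolutely continuous function, hence the integral of its
  -- derivative, which monotonicity makes nonpositive.
  have hN : AbsolutelyContinuousOnInterval (fun t => ‖X t - Y t‖ * ‖X t - Y t‖) 0 T :=
    (hX.sub hY).norm.mul (hX.sub hY).norm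
  have h1 := hN.integral_deriv_eq_sub
  have h2 : ∫ t in (0 : ℝ)..T, deriv (fun t => ‖X t - Y t‖ * ‖X t - Y t‖) t ≤ 0 := by
    rw [intervalIntegral.integral_of_le hT]
    refine integral_nonpos_of_ae ?_
    rw [EventuallyLE, ae_restrict_iff' measurableSet_Ioc]
    filter_upwards [hX', hY'] with t htX htY ht
    obtain ⟨v, hv, hvA⟩ := htX ht.1
    obtain ⟨w, hw, hwA⟩ := htY ht.1
    have h3 : HasDerivAt (fun t => ‖X t - Y t‖ * ‖X t - Y t‖)
        (inner ℝ (X t - Y t) (v - w) + inner ℝ (v - w) (X t - Y t)) t := by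
      have := (hv.sub hw).inner ℝ (hv.sub hw)
      simp only [Pi.sub_apply, real_inner_self_eq_norm_mul_norm] at this
      exact this
    rw [h3.deriv, real_inner_comm]
    have h4 := hA _ _ _ _ hvA hwA
    have e : -v - -w = -(v - w) := by abel
    rw [e, inner_neg_left] at h4
    change _ ≤ (0 : ℝ)
    linarith
  rw [h1, h0, sub_self, norm_zero, mul_zero, sub_zero] at h2
  have h5 : ‖X T - Y T‖ = 0 := by nlinarith [norm_nonneg (X T - Y T)]
  exact sub_eq_zero.1 (norm_eq_zero.1 h5)

end GradientCurve

/-! ### The cone of nondecreasing functions. -/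

namespace EulerAlignment

open Filter Topology

section Cone

theorem ae_mu_mem_Ioo : ∀ᵐ m ∂mu, m ∈ Ioo (0 : ℝ) 1 := ae_restrict_mem measurableSet_Ioo

theorem exists_mem_of_ae_mu {S : Set ℝ} (hS : ∀ᵐ m ∂mu, m ∈ S) {a b : ℝ} (ha : 0 ≤ a) (hb : b ≤ 1)
    (hab : a < b) : ∃ m ∈ S, m ∈ Ioo a b := by
  rw [ae_restrict_iff' measurableSet_Ioo] at hS
  by_contra! hcon
  have h1 : ∀ᵐ m : ℝ, m ∉ Ioo a b := by
    filter_upwards [hS] with m hm hmab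
    exact hcon m (hm ⟨ha.trans_lt hmab.1, hmab.2.trans_le hb⟩) hmab
  rw [ae_iff] at h1
  simp only [not_not] at h1
  have h2 : volume (Ioo a b) = 0 := h1
  rw [Real.volume_Ioo, ENNReal.ofReal_eq_zero] at h2
  linarith

/-- A function that is nondecreasing on a set of full measure belongs to the cone. -/
theorem mem_coneK_of_monotoneOn {X : L2} {S : Set ℝ} (hS : ∀ᵐ m ∂mu, m ∈ S)
    (hX : MonotoneOn X S) : X ∈ coneK := by
  -- Taking the infimum strictly to the right of `m` builds in right-continuity.
  set f : ℝ → ℝ := fun m => sInf (X '' (S ∩ Ioi m)) with hf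
  have hne : ∀ m ∈ Ioo (0 : ℝ) 1, (X '' (S ∩ Ioi m)).Nonempty := by
    intro m hm
    obtain ⟨s, hs, hs'⟩ := exists_mem_of_ae_mu hS hm.1.le le_rfl hm.2
    exact ⟨_, s, ⟨hs, hs'.1⟩, rfl⟩
  have hbd : ∀ m ∈ Ioo (0 : ℝ) 1, BddBelow (X '' (S ∩ Ioi m)) := by
    intro m hm
    obtain ⟨s, hs, hs'⟩ := exists_mem_of_ae_mu hS le_rfl hm.2.le hm.1
    refine ⟨X s, ?_⟩
    rintro _ ⟨r, ⟨hr, hr'⟩, rfl⟩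
    exact hX hs hr (hs'.2.trans hr').le
  have hle : ∀ m ∈ Ioo (0 : ℝ) 1, ∀ s ∈ S, m < s → f m ≤ X s := fun m hm s hs hms =>
    csInf_le (hbd m hm) ⟨s, ⟨hs, hms⟩, rfl⟩
  have hmono : MonotoneOn f (Ioo 0 1) := fun m hm m' hm' hmm' =>
    csInf_le_csInf (hbd m hm) (hne m' hm')
      (image_mono (inter_subset_inter_right _ (Ioi_subset_Ioi hmm')))
  refine ⟨f, hmono, fun m hm => ?_, ?_⟩
  · rw [ContinuousWithinAt, tendsto_order]
    refine ⟨fun c hc => ?_, fun c hc => ?_⟩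
    · filter_upwards [Ico_mem_nhdsGE hm.2] with r hr
      exact hc.trans_le (hmono hm ⟨hm.1.trans_le hr.1, hr.2⟩ hr.1)
    · obtain ⟨_, ⟨s, ⟨hs, hms⟩, rfl⟩, hlt⟩ := exists_lt_of_csInf_lt (hne m hm) hc
      filter_upwards [Ico_mem_nhdsGE (lt_min hms hm.2)] with r hr
      exact (hle r ⟨hm.1.trans_le hr.1, hr.2.trans_le (min_le_right _ _)⟩ s hs
        (hr.2.trans_le (min_le_left _ _))).trans_lt hlt
  -- At continuity points of `f` in `S`, `X m` is squeezed between the left limit of `f` and `f m`.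
  · have hcount := hmono.countable_not_continuousWithinAt.ae_notMem mu
    filter_upwards [hcount, hS, ae_mu_mem_Ioo] with m hm hmS hm01
    have hc : ContinuousWithinAt f (Ioo 0 1) m := by
      by_contra hcon
      exact hm ⟨hm01, hcon⟩
    have hc' : Tendsto f (𝓝[<] m) (𝓝 (f m)) :=
      (hc.continuousAt (isOpen_Ioo.mem_nhds hm01)).tendsto.mono_left nhdsWithin_le_nhds
    refine le_antisymm (le_csInf (hne m hm01) ?_) (le_of_tendsto hc' ?_)
    · rintro _ ⟨s, ⟨hs, hms⟩, rfl⟩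
      exact hX hmS hs (le_of_lt hms)
    · filter_upwards [Ioo_mem_nhdsLT hm01.1] with r hr
      exact hle r ⟨hr.1, hr.2.trans hm01.2⟩ m hmS hr.2

/-- Converse of `mem_coneK_of_monotoneOn`: monotonicity on a full-measure set is the form of
membership stable under combinations and a.e. limits. -/
theorem exists_monotoneOn_of_mem_coneK {X : L2} (hX : X ∈ coneK) :
    ∃ S : Set ℝ, (∀ᵐ m ∂mu, m ∈ S) ∧ MonotoneOn X S := by
  obtain ⟨f, hf, -, hXf⟩ := hX
  refine ⟨{m | X m = f m} ∩ Ioo 0 1, hXf.and ae_mu_mem_Ioo, ?_⟩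
  rintro m ⟨hm, hm'⟩ r ⟨hr, hr'⟩ hmr
  rw [show X m = f m from hm, show X r = f r from hr]
  exact hf hm' hr' hmr

theorem zero_mem_coneK : (0 : L2) ∈ coneK :=
  ⟨fun _ => 0, monotoneOn_const, fun _ _ => continuousWithinAt_const, Lp.coeFn_zero ℝ 2 mu⟩

theorem convex_coneK : Convex ℝ coneK := by
  intro X hX Y hY a b ha hb _
  obtain ⟨S, hS, hXS⟩ := exists_monotoneOn_of_mem_coneK hX
  obtain ⟨R, hR, hYR⟩ := exists_monotoneOn_of_mem_coneK hY
  have he : ∀ᵐ m ∂mu, (a • X + b • Y : L2) m = a * X m + b * Y m := by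
    filter_upwards [Lp.coeFn_add (a • X) (b • Y), Lp.coeFn_smul a X, Lp.coeFn_smul b Y]
      with m h1 h2 h3
    rw [h1, Pi.add_apply, h2, h3]
    rfl
  refine mem_coneK_of_monotoneOn (S := S ∩ R ∩ {m | (a • X + b • Y : L2) m = a * X m + b * Y m})
    ((hS.and hR).and he) ?_
  rintro m ⟨⟨hm1, hm2⟩, hm3⟩ r ⟨⟨hr1, hr2⟩, hr3⟩ hmr
  rw [show (a • X + b • Y : L2) m = _ from hm3, show (a • X + b • Y : L2) r = _ from hr3]
  have h1 := mul_le_mul_of_nonneg_left (hXS hm1 hr1 hmr) ha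
  have h2 := mul_le_mul_of_nonneg_left (hYR hm2 hr2 hmr) hb
  linarith

/-- An `L²`-convergent sequence has an a.e. convergent subsequence, and pointwise limits preserve
monotonicity. -/
theorem isClosed_coneK : IsClosed coneK := by
  refine IsSeqClosed.isClosed fun X Z hX hlim => ?_
  obtain ⟨ns, -, hns⟩ := (tendstoInMeasure_of_tendsto_Lp hlim).exists_seq_tendsto_ae
  choose S hS hXS using fun n => exists_monotoneOn_of_mem_coneK (hX n)
  refine mem_coneK_of_monotoneOn
    (S := (⋂ n, S n) ∩ {m | Tendsto (fun i => X (ns i) m) atTop (𝓝 (Z m))}) ?_ ?_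
  · filter_upwards [ae_all_iff.2 hS, hns] with m h1 h2
    exact ⟨mem_iInter.2 h1, h2⟩
  · rintro m ⟨hm1, hm2⟩ r ⟨hr1, hr2⟩ hmr
    exact le_of_tendsto_of_tendsto' hm2 hr2 fun i =>
      hXS _ (mem_iInter.1 hm1 _) (mem_iInter.1 hr1 _) hmr

end Cone

/-! ### The interaction energy and its subgradient. -/

section Energy

variable {φ : ℝ → ℝ}

theorem IsProtocol.monotone_Phi (h : IsProtocol φ) : Monotone (Phi φ) := by
  intro a b hab
  have h1 : Phi φ a + ∫ z in a..b, φ z = Phi φ b :=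
    intervalIntegral.integral_add_adjacent_intervals (h.intervalIntegrable 0 a)
      (h.intervalIntegrable a b)
  have h2 : 0 ≤ ∫ z in a..b, φ z := intervalIntegral.integral_nonneg hab fun z _ => h.nonneg z
  linarith

theorem IsProtocol.continuous_WPhi (h : IsProtocol φ) : Continuous (WPhi φ) :=
  intervalIntegral.continuous_primitive (fun a b => h.continuous_Phi.intervalIntegrable a b) 0

/-- The tangent inequality of a convex function: the derivative `Φ` of `W_Φ` is nondecreasing. -/
theorem IsProtocol.WPhi_add_le (h : IsProtocol φ) (a b : ℝ) :
    WPhi φ a + Phi φ a * (b - a) ≤ WPhi φ b := by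
  have hi : ∀ s t, IntervalIntegrable (Phi φ) volume s t := fun s t =>
    h.continuous_Phi.intervalIntegrable s t
  have h1 : WPhi φ a + ∫ z in a..b, Phi φ z = WPhi φ b :=
    intervalIntegral.integral_add_adjacent_intervals (hi 0 a) (hi a b)
  have hc : ∀ s t, ∫ _z in s..t, Phi φ a = Phi φ a * (t - s) := fun s t => by
    rw [intervalIntegral.integral_const, smul_eq_mul, mul_comm]
  rcases le_total a b with hab | hab
  · have h2 : ∫ _z in a..b, Phi φ a ≤ ∫ z in a..b, Phi φ z :=
      intervalIntegral.integral_mono_on hab intervalIntegrable_const (hi a b)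
        fun z hz => h.monotone_Phi hz.1
    rw [hc] at h2
    linarith
  · have h2 : ∫ z in b..a, Phi φ z ≤ ∫ _z in b..a, Phi φ a :=
      intervalIntegral.integral_mono_on hab (hi b a) intervalIntegrable_const
        fun z hz => h.monotone_Phi hz.2
    rw [hc] at h2
    rw [intervalIntegral.integral_symm] at h1
    linarith

theorem IsProtocol.growth_nonneg (h : IsProtocol φ) : 0 ≤ Phi φ 1 + φ 1 :=
  add_nonneg (intervalIntegral.integral_nonneg zero_le_one fun z _ => h.nonneg z) (h.nonneg 1)

/-- Linear growth of `Φ` gives quadratic growth of `W_Φ`, so the energy integral converges on all of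
`L²`. -/
theorem IsProtocol.abs_WPhi_le (h : IsProtocol φ) (x : ℝ) :
    |WPhi φ x| ≤ (Phi φ 1 + φ 1) * (2 + 2 * x ^ 2) := by
  have hC := h.growth_nonneg
  have h1 : ‖WPhi φ x‖ ≤ (Phi φ 1 + φ 1) * (1 + |x|) * |x - 0| := by
    refine intervalIntegral.norm_integral_le_of_norm_le_const fun y hy => ?_
    refine (h.abs_Phi_le y).trans ?_
    have : |y| ≤ |x| := by
      have := abs_sub_left_of_mem_uIcc (uIoc_subset_uIcc hy)
      simpa using this
    gcongr
  rw [sub_zero, Real.norm_eq_abs, mul_assoc] at h1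
  refine h1.trans (mul_le_mul_of_nonneg_left ?_ hC)
  nlinarith [sq_abs x, sq_nonneg (|x| - 1), abs_nonneg x]

theorem integrable_sq (X : L2) : Integrable (fun m => X m ^ 2) mu := (Lp.memLp X).integrable_sq

theorem IsProtocol.integrable_WPhi (h : IsProtocol φ) (X : L2) :
    Integrable (fun p : ℝ × ℝ => WPhi φ (X p.1 - X p.2)) (mu.prod mu) := by
  obtain ⟨C, hC⟩ : ∃ C, C = Phi φ 1 + φ 1 := ⟨_, rfl⟩
  have hC0 : 0 ≤ C := hC ▸ h.growth_nonneg
  have hX := Lp.stronglyMeasurable X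
  have hm : StronglyMeasurable (fun p : ℝ × ℝ => WPhi φ (X p.1 - X p.2)) :=
    h.continuous_WPhi.comp_stronglyMeasurable
      ((hX.comp_measurable measurable_fst).sub (hX.comp_measurable measurable_snd))
  have hb : Integrable (fun p : ℝ × ℝ => C * (2 + 4 * X p.1 ^ 2 + 4 * X p.2 ^ 2)) (mu.prod mu) :=
    ((((integrable_const 2).add (((integrable_sq X).comp_fst mu).const_mul 4)).add
      (((integrable_sq X).comp_snd mu).const_mul 4))).const_mul C
  refine hb.mono' hm.aestronglyMeasurable (Eventually.of_forall fun p => ?_)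
  refine (h.abs_WPhi_le _).trans ?_
  rw [← hC]
  refine mul_le_mul_of_nonneg_left ?_ hC0
  nlinarith [sq_nonneg (X p.1 + X p.2)]

theorem IsProtocol.integrable_Phi_mul (h : IsProtocol φ) (X D : L2) :
    Integrable (fun p : ℝ × ℝ => Phi φ (X p.1 - X p.2) * D p.1) (mu.prod mu) := by
  obtain ⟨C, hC⟩ : ∃ C, C = Phi φ 1 + φ 1 := ⟨_, rfl⟩
  have hC0 : 0 ≤ C := hC ▸ h.growth_nonneg
  have hX := Lp.stronglyMeasurable X
  have hm : StronglyMeasurable (fun p : ℝ × ℝ => Phi φ (X p.1 - X p.2) * D p.1) :=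
    (h.continuous_Phi.comp_stronglyMeasurable
      ((hX.comp_measurable measurable_fst).sub (hX.comp_measurable measurable_snd))).mul
      ((Lp.stronglyMeasurable D).comp_measurable measurable_fst)
  have hb : Integrable
      (fun p : ℝ × ℝ => C * (2 + 4 * X p.1 ^ 2 + 4 * X p.2 ^ 2 + D p.1 ^ 2)) (mu.prod mu) :=
    ((((integrable_const 2).add (((integrable_sq X).comp_fst mu).const_mul 4)).add
      (((integrable_sq X).comp_snd mu).const_mul 4)).add
      ((integrable_sq D).comp_fst mu)).const_mul C
  refine hb.mono' hm.aestronglyMeasurable (Eventually.of_forall fun p => ?_)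
  rw [norm_mul, Real.norm_eq_abs, Real.norm_eq_abs]
  have h1 := h.abs_Phi_le (X p.1 - X p.2)
  rw [← hC] at h1
  refine (mul_le_mul_of_nonneg_right h1 (abs_nonneg _)).trans ?_
  rw [mul_assoc]
  refine mul_le_mul_of_nonneg_left ?_ hC0
  nlinarith [sq_nonneg (X p.1 + X p.2), sq_abs (X p.1 - X p.2), sq_abs (D p.1),
    sq_nonneg (1 + |X p.1 - X p.2| - |D p.1|), sq_nonneg (|X p.1 - X p.2| - 1)]

theorem IsProtocol.inner_conv (h : IsProtocol φ) (X D : L2) :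
    inner ℝ (conv h X) D = ∫ p, Phi φ (X p.1 - X p.2) * D p.1 ∂(mu.prod mu) := by
  rw [integral_prod _ (h.integrable_Phi_mul X D), L2.inner_def]
  refine integral_congr_ae ?_
  have hc : conv h X =ᵐ[mu] convFun φ X := MemLp.coeFn_toLp _
  filter_upwards [hc] with m hm
  rw [hm, integral_mul_const, convFun]
  simp [mul_comm]

/-- `Φ ∗ ρ(X)` is a subgradient of the interaction energy at `X`. -/
theorem IsProtocol.energyW_add_inner_le (h : IsProtocol φ) (X Z : L2) :
    energyW φ X + inner ℝ (conv h X) (Z - X) ≤ energyW φ Z := by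
  have hE : ∀ Y : L2, energyW φ Y = (1 / 2) * ∫ p, WPhi φ (Y p.1 - Y p.2) ∂(mu.prod mu) := by
    intro Y
    rw [integral_prod _ (h.integrable_WPhi Y), energyW]
  obtain ⟨D, hD⟩ : ∃ D : L2, D = Z - X := ⟨_, rfl⟩
  have hint := h.integrable_Phi_mul X D
  have hswap : Integrable (fun p : ℝ × ℝ => Phi φ (X p.2 - X p.1) * D p.2) (mu.prod mu) :=
    hint.swap
  have hsw : ∫ p, Phi φ (X p.2 - X p.1) * D p.2 ∂(mu.prod mu) =
      ∫ p, Phi φ (X p.1 - X p.2) * D p.1 ∂(mu.prod mu) :=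
    integral_prod_swap (fun p : ℝ × ℝ => Phi φ (X p.1 - X p.2) * D p.1)
  have hDae : ∀ᵐ m ∂mu, D m = Z m - X m := by
    rw [hD]; exact Lp.coeFn_sub Z X
  -- Oddness of `Φ` splits the tangent term into two pieces exchanged by swapping variables; their
  -- equal integrals cancel the factor `1 / 2`.
  have hmono : ∫ p, (WPhi φ (X p.1 - X p.2) + (Phi φ (X p.1 - X p.2) * D p.1 +
      Phi φ (X p.2 - X p.1) * D p.2)) ∂(mu.prod mu) ≤
      ∫ p, WPhi φ (Z p.1 - Z p.2) ∂(mu.prod mu) := by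
    refine integral_mono_ae ((h.integrable_WPhi X).add (hint.add hswap)) (h.integrable_WPhi Z) ?_
    filter_upwards [Measure.quasiMeasurePreserving_fst.ae hDae,
      Measure.quasiMeasurePreserving_snd.ae hDae] with p h1 h2
    have h3 := h.WPhi_add_le (X p.1 - X p.2) (Z p.1 - Z p.2)
    have h4 := h.Phi_neg (X p.1 - X p.2)
    rw [neg_sub] at h4
    rw [h1, h2, h4]
    linarith
  have hsplit := integral_add (h.integrable_WPhi X) (hint.add hswap)
  simp only [Pi.add_apply] at hsplit
  rw [hsplit, integral_add hint hswap, hsw] at hmono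
  rw [hE, hE, ← hD, h.inner_conv]
  linarith

theorem IsProtocol.potV_add_inner_le (h : IsProtocol φ) (Ψ X Z : L2) :
    potV φ Ψ X + inner ℝ (conv h X - Ψ) (Z - X) ≤ potV φ Ψ Z := by
  have h1 := h.energyW_add_inner_le X Z
  rw [potV, potV, inner_sub_left, inner_sub_right Ψ]
  linarith

end Energy

end EulerAlignment

/-! ### Functions with a subgradient at every point. -/

section Subgradients

variable {H : Type*} [NormedAddCommGroup H] [InnerProductSpace ℝ H] {f : H → ℝ} {g : H → H}

/-- At the convex combination `w`, the weighted subgradient inequalities towards the end points add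
up and their linear terms cancel. -/
theorem convexOn_of_subgradient {K : Set H} (hK : Convex ℝ K)
    (hg : ∀ x z, f x + inner ℝ (g x) (z - x) ≤ f z) : ConvexOn ℝ K f := by
  refine ⟨hK, fun x _ y _ a b ha hb hab => ?_⟩
  obtain ⟨w, hw⟩ : ∃ w, w = a • x + b • y := ⟨_, rfl⟩
  have h1 := mul_le_mul_of_nonneg_left (hg w x) ha
  have h2 := mul_le_mul_of_nonneg_left (hg w y) hb
  have h3 : a * inner ℝ (g w) (x - w) + b * inner ℝ (g w) (y - w) = 0 := by
    rw [← inner_smul_right, ← inner_smul_right, ← inner_add_right]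
    have : a • (x - w) + b • (y - w) = 0 := by
      have e : a • (x - w) + b • (y - w) = a • x + b • y - (a + b) • w := by module
      rw [e, hab, one_smul, hw, sub_self]
    rw [this, inner_zero_right]
  rw [← hw, smul_eq_mul, smul_eq_mul]
  have h4 : a * f w + b * f w = f w := by rw [← add_mul, hab, one_mul]
  linarith

theorem lowerSemicontinuous_of_subgradient (hg : ∀ x z, f x + inner ℝ (g x) (z - x) ≤ f z) :
    LowerSemicontinuous f := by
  intro x c hc
  have h1 : Filter.Tendsto (fun z => f x + inner ℝ (g x) (z - x)) (nhds x)
      (nhds (f x + inner ℝ (g x) (x - x))) := Continuous.tendsto (by fun_prop) x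
  rw [sub_self, inner_zero_right, add_zero] at h1
  filter_upwards [h1.eventually (lt_mem_nhds hc)] with z hz
  exact hz.trans_le (hg x z)

end Subgradients

/-! ### Passage to the extended-valued functional, and the theorem. -/

namespace EulerAlignment

section Flow

variable {φ : ℝ → ℝ} {Ψ : L2}

theorem potVK_of_mem {X : L2} (hX : X ∈ coneK) : potVK φ Ψ X = (potV φ Ψ X : EReal) := by
  rw [potVK, indicatorK, if_pos hX, add_zero]

theorem potVK_of_notMem {X : L2} (hX : X ∉ coneK) : potVK φ Ψ X = ⊤ := by
  rw [potVK, indicatorK, if_neg hX, EReal.coe_add_top]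

theorem properFunctional_potVK : ProperFunctional (potVK φ Ψ) := by
  refine ⟨fun X => ?_, 0, ?_⟩
  · by_cases hX : X ∈ coneK
    · rw [potVK_of_mem hX]; exact EReal.coe_ne_bot _
    · rw [potVK_of_notMem hX]; exact top_ne_bot
  · rw [potVK_of_mem zero_mem_coneK]; exact EReal.coe_ne_top _

theorem convexFunctional_potVK (hf : ConvexOn ℝ coneK (potV φ Ψ)) :
    ConvexFunctional (potVK φ Ψ) := by
  intro X Y θ h0 h1
  have h1' : 0 < 1 - θ := sub_pos.2 h1
  have hbot := (properFunctional_potVK (φ := φ) (Ψ := Ψ)).1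
  have hne : ∀ (c : ℝ) (Z : L2), 0 < c → (c : EReal) * potVK φ Ψ Z ≠ ⊥ := by
    intro c Z hc
    by_cases hZ : Z ∈ coneK
    · rw [potVK_of_mem hZ, ← EReal.coe_mul]; exact EReal.coe_ne_bot _
    · rw [potVK_of_notMem hZ, EReal.coe_mul_top_of_pos hc]; exact top_ne_bot
  by_cases hX : X ∈ coneK
  · by_cases hY : Y ∈ coneK
    · rw [potVK_of_mem hX, potVK_of_mem hY,
        potVK_of_mem (hf.1 hX hY h1'.le h0.le (by ring)), ← EReal.coe_mul, ← EReal.coe_mul,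
        ← EReal.coe_add, EReal.coe_le_coe_iff]
      exact hf.2 hX hY h1'.le h0.le (by ring)
    · rw [potVK_of_notMem hY, EReal.coe_mul_top_of_pos h0,
        EReal.add_top_of_ne_bot (hne _ _ h1')]
      exact le_top
  · rw [potVK_of_notMem hX, EReal.coe_mul_top_of_pos h1', EReal.top_add_of_ne_bot (hne _ _ h0)]
    exact le_top

theorem lowerSemicontinuous_potVK (hf : LowerSemicontinuous (potV φ Ψ)) :
    LowerSemicontinuous (potVK φ Ψ) := by
  rw [lowerSemicontinuous_iff_isClosed_preimage]
  intro c
  induction c with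
  | bot =>
    have : potVK φ Ψ ⁻¹' Iic ⊥ = ∅ := by
      ext X
      simpa using (properFunctional_potVK (φ := φ) (Ψ := Ψ)).1 X
    rw [this]; exact isClosed_empty
  | top => simp
  | coe c =>
    have : potVK φ Ψ ⁻¹' Iic (c : EReal) = coneK ∩ potV φ Ψ ⁻¹' Iic c := by
      ext X
      by_cases hX : X ∈ coneK
      · simp [potVK_of_mem hX, hX]
      · simp [potVK_of_notMem hX, hX]
    rw [this]
    exact isClosed_coneK.inter (hf.isClosed_preimage c)

theorem subdiff_potVK (X : L2) :
    subdiff (potVK φ Ψ) X = constrSubdiff coneK (potV φ Ψ) X := by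
  ext Y
  constructor
  · intro h
    by_cases hX : X ∈ coneK
    · refine ⟨hX, fun Z hZ => ?_⟩
      have h1 := h Z
      rwa [potVK_of_mem hX, potVK_of_mem hZ, ← EReal.coe_add, EReal.coe_le_coe_iff] at h1
    -- Off the cone, testing with `0` would bound `⊤` by a real number.
    · have h1 := h 0
      rw [potVK_of_notMem hX, potVK_of_mem zero_mem_coneK, EReal.top_add_coe] at h1
      exact absurd (top_le_iff.1 h1) (EReal.coe_ne_top _)
  · rintro ⟨hX, h⟩ Z
    by_cases hZ : Z ∈ coneK
    · rw [potVK_of_mem hX, potVK_of_mem hZ, ← EReal.coe_add, EReal.coe_le_coe_iff]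
      exact h Z hZ
    · rw [potVK_of_notMem hZ]; exact le_top

end Flow

end EulerAlignment

theorem theorem4p1 (φ : ℝ → ℝ) (hφ : EulerAlignment.IsProtocol φ)
    (Xbar Vbar Ψbar : EulerAlignment.L2) (hX : Xbar ∈ EulerAlignment.coneK)
    (hΨ : Ψbar = EulerAlignment.naturalVelocity hφ Xbar Vbar) :
    (EulerAlignment.ProperFunctional (EulerAlignment.potVK φ Ψbar) ∧
      EulerAlignment.ConvexFunctional (EulerAlignment.potVK φ Ψbar) ∧
      LowerSemicontinuous (EulerAlignment.potVK φ Ψbar)) ∧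
    ∃ X : ℝ → EulerAlignment.L2,
      EulerAlignment.IsGradientFlow (EulerAlignment.potVK φ Ψbar) X ∧
      X 0 = Xbar ∧
      (∀ t : ℝ, 0 ≤ t → X t ∈ EulerAlignment.coneK) ∧
      EulerAlignment.EvolvesBy
        (EulerAlignment.minSubdiff (EulerAlignment.potVK φ Ψbar)) X ∧
      ∀ Y : ℝ → EulerAlignment.L2,
        EulerAlignment.IsGradientFlow (EulerAlignment.potVK φ Ψbar) Y →
        Y 0 = Xbar → ∀ t : ℝ, 0 ≤ t → Y t = X t := by
  have hsub := hφ.potV_add_inner_le Ψbar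
  have hconv := convexOn_of_subgradient EulerAlignment.convex_coneK hsub
  have hlsc := lowerSemicontinuous_of_subgradient hsub
  refine ⟨⟨EulerAlignment.properFunctional_potVK, EulerAlignment.convexFunctional_potVK hconv,
    EulerAlignment.lowerSemicontinuous_potVK hlsc⟩, ?_⟩
  -- The initial subgradient is `conv hφ Xbar - Ψbar`, that is `-Vbar`.
  obtain ⟨X, hX0, hXK, hlip, hflow⟩ := exists_gradientCurve EulerAlignment.isClosed_coneK hconv
    (hlsc.lowerSemicontinuousOn _) ⟨hX, fun z _ => hsub Xbar z⟩
  have hAC : EulerAlignment.LocallyAC X := by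
    intro T hT
    refine LipschitzOnWith.absolutelyContinuousOnInterval
      (K := ‖EulerAlignment.conv hφ Xbar - Ψbar‖₊) (LipschitzOnWith.of_dist_le_mul ?_)
    intro s hs t ht
    rw [uIcc_of_le hT] at hs ht
    rw [coe_nnnorm, dist_eq_norm, Real.dist_eq, mul_comm]
    rcases le_total s t with hst | hst
    · rw [norm_sub_rev, abs_sub_comm, abs_of_nonneg (sub_nonneg.2 hst)]
      exact hlip s t hs.1 hst
    · rw [abs_of_nonneg (sub_nonneg.2 hst)]
      exact hlip t s ht.1 hst
  have hmin : EulerAlignment.EvolvesBy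
      (EulerAlignment.minSubdiff (EulerAlignment.potVK φ Ψbar)) X := by
    filter_upwards [hflow] with t ht ht0
    obtain ⟨v, hv, hvs, hvmin⟩ := ht ht0
    refine ⟨v, hv, ?_, ?_⟩
    · rwa [EulerAlignment.subdiff_potVK]
    · rw [EulerAlignment.subdiff_potVK, norm_neg]
      exact hvmin
  have hgf : EulerAlignment.EvolvesBy
      (EulerAlignment.subdiff (EulerAlignment.potVK φ Ψbar)) X := by
    filter_upwards [hmin] with t ht ht0
    obtain ⟨v, hv, hvs⟩ := ht ht0
    exact ⟨v, hv, hvs.1⟩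
  refine ⟨X, ⟨hAC, hgf⟩, hX0, hXK, hmin, fun Y hY hY0 t ht => ?_⟩
  refine eq_of_evolves_by_monotone (A := EulerAlignment.subdiff (EulerAlignment.potVK φ Ψbar))
    ?_ ht (hY.1 t ht) (hAC t ht) hY.2 hgf (hY0.trans hX0.symm)
  intro x x' y y' hy hy'
  rw [EulerAlignment.subdiff_potVK] at hy hy'
  exact constrSubdiff_monotone hy hy'
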